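/- **Theorem (Equivalence Theorem).** Let $\mathbb X$ be a measurable space, $\mathcal T$ a Markov transition kernel on $\mathbb X$ and $q:\mathbb X\to[0,1]$ a measurable acceptance rate. Assume that $q$ is constant (this assumption may be dropped if there is no point transition, i.e. $\mathcal T(x,\cdot)=\delta_x$). For $j\ge 1$ let $\nu_j$ be a measure on $(0,\infty)\times\mathbb X$ with $\int t\,\nu_j(dt,dx)<\infty$ and $\nu_j((0,\infty)\times\mathbb X)=\infty$, let $\{(J_{jk},x_{jk})\}_k$ be independent Poisson processes with mean measures $\nu_j$, let $\tilde\mu_j=\sum_k J_{jk}\delta_{x_{jk}}$ be the corresponding independent completely random measures (CRMs) with Lévy measures $\nu_j$, and let $\mu_j=\tilde\mu_j/\tilde\mu_j(\mathbb X)$ be the normalised random measures (NRMs). For a CRM $\tilde\mu=\sum_kJ_k\delta_{\theta_k}$ let $\tilde S^q(\tilde\mu)=\sum_k z_kJ_k\delta_{\theta_k}$, where the $z_k$ are independent Bernoulli variables with $P(z_k=1)=q(\theta_k)$, and $\tilde T(\tilde\mu)=\sum_kJ_k\delta_{\theta_k'}$, where the $\theta'_k$ are independent with laws $\mathcal T(\theta_k,\cdot)$;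 superposition $\tilde\oplus$ is addition. For an NRM $\mu=\sum_kr_k\delta_{\theta_k}$ let $S^q(\mu)=\sum_k\frac{z_kr_k}{\sum_iz_ir_i}\delta_{\theta_k}$ and $T(\mu)=\sum_kr_k\delta_{\theta'_k}$; superposition is $\mu\oplus\mu'=\frac{w}{w+w'}\mu+\frac{w'}{w+w'}\mu'$, where $w,w'$ are the total masses of the underlying unnormalised measures (the underlying mass of $\mu_j$ is $\tilde\mu_j(\mathbb X)$; it is multiplied by $\sum_iz_ir_i$ under $S^q$, unchanged under $T$, and added under $\oplus$). The operations act on the underlying points, each with its own $z_k$ and $\theta_k'$. The normalisation of the zero measure is taken to be the zero measure. Fresh randomness, independent of all inputs and of the past, is used in every step. Define the dependent random measures $$\tilde\mu_1'=\tilde\mu_1,\quad \tilde\mu_m'\sim\tilde T(\tilde S^q(\tilde\mu'_{m-1}))\,\tilde\oplus\,\tilde\mu_m\quad(m>1),\tag{1}$$ and, at the level of normalised random measures, $$\mu_1'=\mu_1,\quad \mu_m'\sim T(S^q(\mu'_{m-1}))\oplus\mu_m\quad(m>1).\tag{2}$$ Then the sequence $(\mu_m')_{m\ge1}$ of (2)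 and the sequence $(\tilde\mu_m'/\tilde\mu_m'(\mathbb X))_{m\ge1}$ obtained from (1) are the same in law, jointly with the inputs (the points of the $\tilde\mu_j$, $j\ge1$). Furthermore, for every $m$, both $\mu'_m$ are equal in law to the mixture $$\sum_{j=1}^m\frac{(q^{m-j}\tilde\mu_j)(\mathbb X)}{\sum_{j'=1}^m(q^{m-j'}\tilde\mu_{j'})(\mathbb X)}\;T^{m-j}\!\left(\frac{q^{m-j}\tilde\mu_j}{(q^{m-j}\tilde\mu_j)(\mathbb X)}\right),$$ where $T^{m-j}$ is point transition applied $m-j$ times, independently for different $j$, and $q^{m-j}\tilde\mu_j$ $(1\le j\le m)$ are any independent CRMs with Lévy measures $q(x)^{m-j}\nu_j(dt,dx)$. If moreover $q^{m-j}\tilde\mu_j$ is realised as the subsampling $\tilde S^{q^{m-j}}(\tilde\mu_j)$ of the input, independently for different $j$ given the inputs, then the equality in law holds conditionally on all inputs. -/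

import Mathlib

open MeasureTheory ProbabilityTheory
open scoped NNReal ENNReal unitInterval

namespace DependentNRM

noncomputable section

/-! ### Independent products of Markov kernels -/

/-- The kernel that applies the Markov kernels `κ i` independently to the coordinates of a family:
a family `a` is sent to the law of independent `(b i)`, with `b i` of law `κ i (a i)`. -/
def piKernel {ι α β : Type*} [MeasurableSpace α] [MeasurableSpace β]
    (κ : ι → Kernel α β) [∀ i, IsMarkovKernel (κ i)] : Kernel (ι → α) (ι → β) where
  toFun a := Measure.infinitePi (fun i => κ i (a i))
  measurable' := by
    refine Measurable.measure_of_isPiSystem_of_isProbabilityMeasure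
      generateFrom_squareCylinders.symm
      (isPiSystem_squareCylinders (fun _ => MeasurableSpace.isPiSystem_measurableSet)
        (fun _ => MeasurableSet.univ)) ?_
    rintro _ ⟨s, t, ht, rfl⟩
    have ht' : ∀ i, MeasurableSet (t i) := fun i => ht i (Set.mem_univ i)
    have h : (fun a : ι → α => Measure.infinitePi (fun i => κ i (a i)) ((s : Set ι).pi t)) =
        fun a => ∏ i ∈ s, κ i (a i) (t i) := by
      funext a
      exact Measure.infinitePi_pi _ (fun i _ => ht' i)
    rw [h]
    exact Finset.measurable_prod _ fun i _ =>
      ((κ i).measurable_coe (ht' i)).comp (measurable_pi_apply i)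

instance {ι α β : Type*} [MeasurableSpace α] [MeasurableSpace β]
    (κ : ι → Kernel α β) [∀ i, IsMarkovKernel (κ i)] : IsMarkovKernel (piKernel κ) :=
  ⟨fun a => inferInstanceAs
    (IsProbabilityMeasure (Measure.infinitePi (fun i => κ i (a i))))⟩

instance isMarkovKernel_pow {α : Type*} [MeasurableSpace α] (κ : Kernel α α) [IsMarkovKernel κ]
    (n : ℕ) : IsMarkovKernel (κ ^ n) := by
  induction n with
  | zero => exact inferInstanceAs (IsMarkovKernel (Kernel.id : Kernel α α))
  | succ n ih =>
    rw [pow_succ]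
    exact inferInstanceAs (IsMarkovKernel ((κ ^ n) ∘ₖ κ))

/-! ### Weighted point sequences and their measures -/

/-- A sequence `(J k, x k)` of weighted points of `X`; points of weight `0` are regarded as
absent. -/
abbrev Config (X : Type*) : Type _ := ℕ → ℝ≥0 × X

section Config

variable {X : Type*} [MeasurableSpace X]

/-- The purely atomic measure `∑ k, J k • δ_{x k}` on `X`. -/
def toMeasure (c : Config X) : Measure X :=
  Measure.sum fun k => ((c k).1 : ℝ≥0∞) • Measure.dirac (c k).2

/-- The counting measure on `ℝ≥0 × X` of the points of positive weight, `∑ k, δ_{(J k, x k)}`. -/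
def pointCount (c : Config X) : Measure (ℝ≥0 × X) :=
  Measure.sum fun k => if 0 < (c k).1 then Measure.dirac (c k) else 0

/-- The total mass `∑ k, J k`. -/
def totalMass (c : Config X) : ℝ≥0∞ := ∑' k, ((c k).1 : ℝ≥0∞)

/-- The normalisation `μ / μ(X)` (the zero measure if `μ = 0`). -/
def normalize (μ : Measure X) : Measure X := (μ Set.univ)⁻¹ • μ

/-- Multiplication of all weights by a constant. -/
def scale (a : ℝ≥0) (c : Config X) : Config X := fun k => (a * (c k).1, (c k).2)

/-- Union of two sequences of weighted points. -/
def superpose (c d : Config X) : Config X :=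
  fun k => Sum.elim c d (Equiv.natSumNatEquivNat.symm k)

/-! ### Poisson processes and Lévy measures -/

/-- The points of `π` form a Poisson process on `(0, ∞) × X` with mean measure `ν`:
`N(A)` is Poisson distributed with mean `ν(A)`, and `N` is independent on disjoint sets.
Thus `toMeasure ∘ π` is a completely random measure with Lévy measure `ν`. -/
structure IsPoisson {Ω : Type*} [MeasurableSpace Ω] (P : Measure Ω) (π : Ω → Config X)
    (ν : Measure (ℝ≥0 × X)) : Prop where
  measurable : Measurable π
  poisson : ∀ A, MeasurableSet A → ν A ≠ ∞ →
    HasLaw (fun ω => pointCount (π ω) A)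
      ((poissonMeasure (ν A).toNNReal).map (fun n : ℕ => (n : ℝ≥0∞))) P
  poisson_top : ∀ A, MeasurableSet A → ν A = ∞ → ∀ᵐ ω ∂P, pointCount (π ω) A = ∞
  indep : ∀ (n : ℕ) (A : Fin n → Set (ℝ≥0 × X)), (∀ i, MeasurableSet (A i)) →
    Pairwise (fun i j => Disjoint (A i) (A j)) →
    iIndepFun (fun i ω => pointCount (π ω) (A i)) P

/-- Lévy measures: carried by `(0, ∞) × X`, with finite mean total mass, and infinite (so that the
random measure is positive). -/
structure IsLevyMeasure (ν : Measure (ℝ≥0 × X)) : Prop where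
  zero : ν ({0} ×ˢ Set.univ) = 0
  finite_mean : ∫⁻ p, (p.1 : ℝ≥0∞) ∂ν ≠ ∞
  infinite : ν Set.univ = ∞

/-! ### Operations on completely random measures -/

/-- Keep the point `(t, x)` with probability `q x`, otherwise set its weight to `0`. -/
def thinPoint (q : X → I) (hq : Measurable q) : Kernel (ℝ≥0 × X) (ℝ≥0 × X) where
  toFun p := ENNReal.ofReal (q p.2) • Measure.dirac p +
    ENNReal.ofReal (1 - q p.2) • Measure.dirac (0, p.2)
  measurable' := by
    have h1 : Measurable fun p : ℝ≥0 × X => ENNReal.ofReal (q p.2) := by fun_prop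
    have h2 : Measurable fun p : ℝ≥0 × X => ENNReal.ofReal (1 - q p.2) := by fun_prop
    refine Measure.measurable_of_measurable_coe _ fun s hs => ?_
    simp only [Measure.add_apply, Measure.smul_apply, smul_eq_mul]
    refine (h1.mul ((Measure.measurable_coe hs).comp Measure.measurable_dirac)).add
      (h2.mul ((Measure.measurable_coe hs).comp (Measure.measurable_dirac.comp ?_)))
    fun_prop

instance (q : X → I) (hq : Measurable q) : IsMarkovKernel (thinPoint q hq) := by
  refine ⟨fun p => ⟨?_⟩⟩
  change ENNReal.ofReal (q p.2) * (Measure.dirac p) Set.univ +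
    ENNReal.ofReal (1 - q p.2) * (Measure.dirac ((0 : ℝ≥0), p.2)) Set.univ = 1
  rw [measure_univ, measure_univ, mul_one, mul_one,
    ← ENNReal.ofReal_add (q p.2).2.1 (sub_nonneg.2 (q p.2).2.2)]
  simp

/-- Move the point `(t, x)` to `(t, y)`, where `y` has law `T x`. -/
def movePoint (T : Kernel X X) : Kernel (ℝ≥0 × X) (ℝ≥0 × X) :=
  (Kernel.id : Kernel ℝ≥0 ℝ≥0) ∥ₖ T

instance (T : Kernel X X) [IsMarkovKernel T] : IsMarkovKernel (movePoint T) :=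
  inferInstanceAs (IsMarkovKernel ((Kernel.id : Kernel ℝ≥0 ℝ≥0) ∥ₖ T))

/-- Subsampling with acceptance rate `q`, by independent Bernoulli trials for all points. -/
def subsample (q : X → I) (hq : Measurable q) : Kernel (Config X) (Config X) :=
  piKernel fun _ => thinPoint q hq

/-- Point transition: all points move independently, following the transition kernel `T`. -/
def transition (T : Kernel X X) [IsMarkovKernel T] : Kernel (Config X) (Config X) :=
  piKernel fun _ => movePoint T

instance (q : X → I) (hq : Measurable q) : IsMarkovKernel (subsample q hq) :=
  inferInstanceAs (IsMarkovKernel (piKernel fun _ : ℕ => thinPoint q hq))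

instance (T : Kernel X X) [IsMarkovKernel T] : IsMarkovKernel (transition T) :=
  inferInstanceAs (IsMarkovKernel (piKernel fun _ : ℕ => movePoint T))

end Config

/-! ### Operations on normalised random measures -/

/-- A realisation of a normalised random measure: its weighted atoms `(r k, x k)`, together with
the total mass of the underlying unnormalised measure, which enters the superposition. -/
abbrev NRM (X : Type*) : Type _ := Config X × ℝ≥0

section NRM

variable {X : Type*} [MeasurableSpace X]

/-- Divide the weights by their sum `s`, and multiply the underlying total mass by `s`. -/
def renormalize (a : NRM X) : NRM X :=
  (scale (totalMass a.1).toNNReal⁻¹ a.1, a.2 * (totalMass a.1).toNNReal)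

/-- The normalised random measure of a completely random measure: weights `J k / ∑ j, J j`. -/
def toNRM (c : Config X) : NRM X := renormalize (c, 1)

/-- Superposition of normalised random measures, `c₁ μ₁ + c₂ μ₂` with `c_i` proportional to the
underlying total masses. -/
def superposeNRM (a b : NRM X) : NRM X :=
  (superpose (scale (a.2 / (a.2 + b.2)) a.1) (scale (b.2 / (a.2 + b.2)) b.1), a.2 + b.2)

theorem measurable_totalMass : Measurable (totalMass : Config X → ℝ≥0∞) :=
  Measurable.tsum fun k => by fun_prop

theorem measurable_superpose :
    Measurable (fun p : Config X × Config X => superpose p.1 p.2) := by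
  refine measurable_pi_lambda _ fun k => ?_
  unfold superpose
  rcases Equiv.natSumNatEquivNat.symm k with i | i
  · exact (measurable_pi_apply i).comp measurable_fst
  · exact (measurable_pi_apply i).comp measurable_snd

theorem measurable_scale :
    Measurable (fun p : ℝ≥0 × Config X => scale p.1 p.2) := by
  refine measurable_pi_lambda _ fun k => ?_
  unfold scale
  fun_prop

theorem measurable_renormalize : Measurable (renormalize : NRM X → NRM X) := by
  have h : Measurable fun a : NRM X => (totalMass a.1).toNNReal :=
    (measurable_totalMass.comp measurable_fst).ennreal_toNNReal
  exact (measurable_scale.comp (h.inv.prodMk measurable_fst)).prodMk (measurable_snd.mul h)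

theorem measurable_toNRM : Measurable (toNRM : Config X → NRM X) :=
  measurable_renormalize.comp (measurable_id.prodMk measurable_const)

theorem measurable_superposeNRM :
    Measurable (fun p : NRM X × NRM X => superposeNRM p.1 p.2) := by
  refine Measurable.prodMk ?_ (by fun_prop)
  refine measurable_superpose.comp (Measurable.prodMk ?_ ?_)
  · exact measurable_scale.comp (Measurable.prodMk (by fun_prop) (by fun_prop))
  · exact measurable_scale.comp (Measurable.prodMk (by fun_prop) (by fun_prop))

theorem measurable_toMeasure : Measurable (toMeasure : Config X → Measure X) := by
  refine Measure.measurable_of_measurable_coe _ fun s hs => ?_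
  simp only [toMeasure, Measure.sum_apply _ hs, Measure.smul_apply, smul_eq_mul]
  refine Measurable.tsum fun k => Measurable.mul (by fun_prop) ?_
  exact (Measure.measurable_coe hs).comp (Measure.measurable_dirac.comp (by fun_prop))

/-- Subsampling of normalised random measures: independent Bernoulli trials for all atoms, followed
by division of the retained weights by their sum. -/
def subsampleNRM (q : X → I) (hq : Measurable q) : Kernel (NRM X) (NRM X) :=
  (subsample q hq ∥ₖ (Kernel.id : Kernel ℝ≥0 ℝ≥0)).map renormalize

/-- Point transition of normalised random measures: the atoms move, the weights are unchanged. -/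
def transitionNRM (T : Kernel X X) [IsMarkovKernel T] : Kernel (NRM X) (NRM X) :=
  transition T ∥ₖ (Kernel.id : Kernel ℝ≥0 ℝ≥0)

instance (q : X → I) (hq : Measurable q) : IsMarkovKernel (subsampleNRM q hq) :=
  Kernel.IsMarkovKernel.map _ measurable_renormalize

instance (T : Kernel X X) [IsMarkovKernel T] : IsMarkovKernel (transitionNRM T) :=
  inferInstanceAs (IsMarkovKernel (transition T ∥ₖ (Kernel.id : Kernel ℝ≥0 ℝ≥0)))

end NRM

/-! ### The recursion -/

/-- `Y 0 = inp 0` and `Y (m + 1) ∼ K (Y m) ⊕ inp (m + 1)`, where the randomness of `K` is fresh: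
given all inputs and `Y 0, …, Y m`, the conditional law of `Y (m + 1)` is the law of
`V ⊕ inp (m + 1)` with `V` of law `K (Y m)`. -/
structure IsRecursion {E Ω : Type*} [MeasurableSpace E] [MeasurableSpace Ω] (P : Measure Ω)
    (K : Kernel E E) (op : E → E → E) (inp Y : ℕ → Ω → E) : Prop where
  zero : Y 0 =ᵐ[P] inp 0
  succ : ∀ m, HasCondDistrib (Y (m + 1))
    (fun ω => ((fun j => inp j ω, fun i => Y i ω) : (ℕ → E) × (Fin (m + 1) → E)))
    (((K.comap (fun h : (ℕ → E) × (Fin (m + 1) → E) => h.2 (Fin.last m))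
        ((measurable_pi_apply _).comp measurable_snd)) ×ₖ
      (Kernel.deterministic (fun h : (ℕ → E) × (Fin (m + 1) → E) => h.1 (m + 1))
        ((measurable_pi_apply _).comp measurable_fst))).map (fun p => op p.1 p.2)) P

/-! ### The mixture -/

section Mixture

variable {X : Type*} [MeasurableSpace X]

/-- Given `η 0, …, η m`, the law of the random measure
`∑ j, (η j)(X) / (∑ j', (η j')(X)) • T^(m - j) (η j / (η j)(X))`,
with independent point transitions for the different `j`. -/
def mixture (T : Kernel X X) [IsMarkovKernel T] (m : ℕ) :
    Kernel (Fin (m + 1) → Config X) (Measure X) :=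
  ((Kernel.id : Kernel (Fin (m + 1) → Config X) (Fin (m + 1) → Config X)) ×ₖ
    ((piKernel fun j : Fin (m + 1) => transitionNRM T ^ (m - (j : ℕ))).comap
      (fun η j => toNRM (η j))
      (measurable_pi_lambda _ fun j => measurable_toNRM.comp (measurable_pi_apply j)))).map
    fun p => ∑ j, (totalMass (p.1 j) / ∑ i, totalMass (p.1 i)) • toMeasure (p.2 j).1

theorem measurable_mixture_sum (m : ℕ) :
    Measurable fun p : (Fin (m + 1) → Config X) × (Fin (m + 1) → NRM X) =>
      ∑ j, (totalMass (p.1 j) / ∑ i, totalMass (p.1 i)) • toMeasure (p.2 j).1 := by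
  have h : ∀ j, Measurable fun p : (Fin (m + 1) → Config X) × (Fin (m + 1) → NRM X) =>
      totalMass (p.1 j) := fun j =>
    measurable_totalMass.comp ((measurable_pi_apply j).comp measurable_fst)
  refine Measure.measurable_of_measurable_coe _ fun s hs => ?_
  simp only [Measure.coe_finsetSum, Finset.sum_apply, Measure.smul_apply, smul_eq_mul]
  refine Finset.measurable_sum _ fun j _ => ((h j).div
    (Finset.measurable_sum _ fun i _ => h i)).mul ?_
  exact (Measure.measurable_coe hs).comp (measurable_toMeasure.comp (by fun_prop))

instance (T : Kernel X X) [IsMarkovKernel T] (m : ℕ) : IsMarkovKernel (mixture T m) :=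
  Kernel.IsMarkovKernel.map _ (measurable_mixture_sum m)

theorem measurable_pow {q : X → I} (hq : Measurable q) (n : ℕ) :
    Measurable fun x => q x ^ n := by
  refine Measurable.subtype_mk (f := fun x => ((q x : ℝ)) ^ n) ?_
  fun_prop

/-- Given the inputs, `(q^(m - j) η_j)` for `j = 0, …, m`, realised by independent subsamplings of
the inputs with acceptance rates `q^(m - j)`. -/
def subsampleInputs (q : X → I) (hq : Measurable q) (m : ℕ) :
    Kernel (ℕ → Config X) (Fin (m + 1) → Config X) :=
  (piKernel fun j : Fin (m + 1) =>
    subsample (fun x => q x ^ (m - (j : ℕ))) (measurable_pow hq _)).comap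
    (fun c j => c j) (measurable_pi_lambda _ fun _ => measurable_pi_apply _)

/-- The measure `q^n(dx) ν(dt, dx)`. -/
def powRate (q : X → I) (n : ℕ) (ν : Measure (ℝ≥0 × X)) : Measure (ℝ≥0 × X) :=
  ν.withDensity fun p => ENNReal.ofReal ((q p.2 : ℝ) ^ n)

end Mixture

end

end DependentNRM

/-!
Write `S` for subsampling, `T` for point transition and `⊕` for superposition.

*The two recursions agree.* For a configuration `c` of finite total mass, `toNRM` intertwines the
operations: subsampling `toNRM c` has the law of `toNRM` of a subsample of `c`
(`subsampleNRM_toNRM`), likewise for point transition (`transitionNRM_toNRM`), and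
`toNRM c ⊕ toNRM d = toNRM (c ⊕ d)` (`superposeNRM_toNRM`), since the total mass is carried along.
All configurations involved have finite mass almost surely (`IsPoisson.totalMass_lt_top`), so the
normalisation of the unnormalised recursion satisfies the normalised one (`IsRecursion.toNRM`). A
recursion determines its law jointly with its inputs (`IsRecursion.map_eq`), and `π j` can be
recovered from `toNRM (π j)`.

*Conditional law.* The kernels act independently on the points, hence separately on the parts of a
superposition (`piKernel_superpose`). So, given the inputs, the `m`-th term is the iterated
superposition of independent configurations with laws `(T S) ^ (m - j) (π j)`
(`termKernel_superpose`). As the acceptance rate does not change along the transitions (it is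
constant, or no point moves), `(T S) ^ n` is one subsampling with rate `q ^ n`, followed by `n`
transitions (`movePoint_comp_thinPoint_pow`). Normalising the sum gives the mixture
(`mixture_comp_infinitePi`).

*Arbitrary Poisson processes.* A configuration also records a labelling of the points, which a
Poisson process leaves undetermined. The mixture depends only on the laws of the random measures
obtained by moving the points, and these are determined by their Laplace functionals
(`ext_of_laplace`, by Stone–Weierstrass). The Laplace functional of a Poisson process
(`IsPoisson.laplace`) shows that they are the same for a subsampled Poisson process with mean
measure `ν` and a Poisson process with mean measure `q ^ n • ν`
(`map_toMeasure_transition_subsample`).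
-/

namespace DependentNRM

noncomputable section

/-! ### Products of kernels -/

section PiKernel

variable {ι α β γ : Type*} [MeasurableSpace α] [MeasurableSpace β] [MeasurableSpace γ]

theorem piKernel_apply (κ : ι → Kernel α β) [∀ i, IsMarkovKernel (κ i)] (a : ι → α) :
    piKernel κ a = Measure.infinitePi fun i => κ i (a i) := rfl

theorem lintegral_infinitePi_finset_prod (μ : ι → Measure α) [∀ i, IsProbabilityMeasure (μ i)]
    (s : Finset ι) {f : ι → α → ℝ≥0∞} (hf : ∀ i, Measurable (f i)) :
    ∫⁻ a, ∏ i ∈ s, f i (a i) ∂Measure.infinitePi μ = ∏ i ∈ s, ∫⁻ x, f i x ∂μ i := by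
  have h := lintegral_prod_eq_prod_lintegral_of_indepFun (μ := Measure.infinitePi μ) s
    (fun i a => f i (a i)) (iIndepFun_infinitePi (P := μ) (X := fun i x => f i x) hf)
    (fun i => (hf i).comp (measurable_pi_apply i))
  rw [h]
  refine Finset.prod_congr rfl fun i _ => ?_
  rw [← (measurePreserving_eval_infinitePi μ i).lintegral_comp (hf i)]

theorem piKernel_comp_infinitePi (κ : ι → Kernel α β) [∀ i, IsMarkovKernel (κ i)]
    (μ : ι → Measure α) [∀ i, IsProbabilityMeasure (μ i)] :
    piKernel κ ∘ₘ Measure.infinitePi μ = Measure.infinitePi fun i => κ i ∘ₘ μ i := by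
  refine Measure.eq_infinitePi _ fun s t ht => ?_
  rw [Measure.bind_apply (MeasurableSet.pi s.countable_toSet fun i _ => ht i)
    (Kernel.aemeasurable _)]
  have h : ∀ a : ι → α, piKernel κ a ((s : Set ι).pi t) = ∏ i ∈ s, κ i (a i) (t i) := fun a =>
    Measure.infinitePi_pi _ fun i _ => ht i
  simp_rw [h]
  rw [lintegral_infinitePi_finset_prod μ s fun i => (κ i).measurable_coe (ht i)]
  exact Finset.prod_congr rfl fun i _ => (Measure.bind_apply (ht i) (Kernel.aemeasurable _)).symm

theorem piKernel_comp (κ' : ι → Kernel β γ) (κ : ι → Kernel α β) [∀ i, IsMarkovKernel (κ' i)]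
    [∀ i, IsMarkovKernel (κ i)] :
    piKernel κ' ∘ₖ piKernel κ = piKernel fun i => κ' i ∘ₖ κ i := by
  refine Kernel.ext fun a => ?_
  rw [Kernel.comp_apply, piKernel_apply, piKernel_comp_infinitePi, piKernel_apply]
  simp_rw [Kernel.comp_apply]

theorem piKernel_pow (κ : Kernel α α) [IsMarkovKernel κ] (n : ℕ) :
    (piKernel fun _ : ι => κ) ^ n = piKernel fun _ : ι => κ ^ n := by
  induction n with
  | zero =>
    refine Kernel.ext fun a => ?_
    change Kernel.id a = Measure.infinitePi fun i => Kernel.id (a i)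
    simp [Kernel.id_apply]
  | succ n ih =>
    rw [pow_succ, ih]
    change (piKernel fun _ : ι => κ ^ n) ∘ₖ (piKernel fun _ : ι => κ) = _
    rw [piKernel_comp]
    rfl

end PiKernel

/-! ### Commutation of subsampling and point transition -/

section Points

variable {X : Type*} [MeasurableSpace X]

theorem thinPoint_apply (q : X → I) (hq : Measurable q) (p : ℝ≥0 × X) :
    thinPoint q hq p = ENNReal.ofReal (q p.2) • Measure.dirac p +
      ENNReal.ofReal (1 - q p.2) • Measure.dirac (0, p.2) := rfl

theorem lintegral_thinPoint (q : X → I) (hq : Measurable q) (p : ℝ≥0 × X)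
    {f : ℝ≥0 × X → ℝ≥0∞} (hf : Measurable f) :
    ∫⁻ z, f z ∂thinPoint q hq p =
      ENNReal.ofReal (q p.2) * f p + ENNReal.ofReal (1 - q p.2) * f (0, p.2) := by
  rw [thinPoint_apply, lintegral_add_measure, lintegral_smul_measure, lintegral_smul_measure,
    lintegral_dirac' _ hf, lintegral_dirac' _ hf, smul_eq_mul, smul_eq_mul]

theorem lintegral_movePoint (T : Kernel X X) [IsMarkovKernel T] (p : ℝ≥0 × X)
    {f : ℝ≥0 × X → ℝ≥0∞} (hf : Measurable f) :
    ∫⁻ z, f z ∂movePoint T p = ∫⁻ y, f (p.1, y) ∂T p.2 := by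
  rw [movePoint, Kernel.lintegral_parallelComp _ hf, Kernel.id_apply, lintegral_dirac']
  exact Measurable.lintegral_prod_right' (f := fun z : ℝ≥0 × X => f z) hf

/-- Two kernels agree if they integrate all nonnegative functions alike. -/
theorem kernel_ext_lintegral {α β : Type*} [MeasurableSpace α] [MeasurableSpace β]
    {κ η : Kernel α β}
    (h : ∀ a, ∀ f : β → ℝ≥0∞, Measurable f → ∫⁻ b, f b ∂κ a = ∫⁻ b, f b ∂η a) : κ = η :=
  Kernel.ext fun a => Measure.ext_of_lintegral _ fun f hf => h a f hf

/-- If the acceptance rate does not change along the transitions, thinning commutes with moving. -/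
theorem thinPoint_comp_movePoint (T : Kernel X X) [IsMarkovKernel T] (q : X → I)
    (hq : Measurable q) (hinv : ∀ x, ∀ᵐ y ∂T x, q y = q x) :
    thinPoint q hq ∘ₖ movePoint T = movePoint T ∘ₖ thinPoint q hq := by
  refine kernel_ext_lintegral fun p f hf => ?_
  have h1 : Measurable fun y => f (p.1, y) := by fun_prop
  have h0 : Measurable fun y => f ((0 : ℝ≥0), y) := by fun_prop
  rw [Kernel.lintegral_comp _ _ _ hf, Kernel.lintegral_comp _ _ _ hf,
    lintegral_thinPoint q hq p hf.lintegral_kernel,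
    lintegral_movePoint T p hf.lintegral_kernel, lintegral_movePoint T _ hf,
    lintegral_movePoint T _ hf]
  simp_rw [lintegral_thinPoint q hq _ hf]
  rw [lintegral_congr_ae (g := fun y => ENNReal.ofReal (q p.2) * f (p.1, y) +
      ENNReal.ofReal (1 - q p.2) * f (0, y)) ?_,
    lintegral_add_left (h1.const_mul _), lintegral_const_mul _ h1, lintegral_const_mul _ h0]
  filter_upwards [hinv p.2] with y hy
  rw [hy]

theorem thinPoint_comp_thinPoint (q r : X → I) (hq : Measurable q) (hr : Measurable r)
    (hqr : Measurable fun x => q x * r x) :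
    thinPoint q hq ∘ₖ thinPoint r hr = thinPoint (fun x => q x * r x) hqr := by
  refine kernel_ext_lintegral fun p f hf => ?_
  rw [Kernel.lintegral_comp _ _ _ hf, lintegral_thinPoint _ _ _ hf.lintegral_kernel,
    lintegral_thinPoint _ _ _ hf, lintegral_thinPoint _ _ _ hf, lintegral_thinPoint _ _ _ hf]
  simp only [Set.Icc.coe_mul]
  have hq0 := (q p.2).2.1
  have hq1 := sub_nonneg.2 (q p.2).2.2
  have hr0 := (r p.2).2.1
  have hr1 := sub_nonneg.2 (r p.2).2.2
  have e1 : ENNReal.ofReal (q p.2 * r p.2 : ℝ) =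
      ENNReal.ofReal (r p.2) * ENNReal.ofReal (q p.2) := by
    rw [← ENNReal.ofReal_mul hr0, mul_comm]
  have e2 : ENNReal.ofReal (1 - q p.2 * r p.2 : ℝ) =
      ENNReal.ofReal (r p.2) * ENNReal.ofReal (1 - q p.2) +
      ENNReal.ofReal (1 - r p.2) * (ENNReal.ofReal (q p.2) + ENNReal.ofReal (1 - q p.2)) := by
    rw [← ENNReal.ofReal_add hq0 hq1, ← ENNReal.ofReal_mul hr0, ← ENNReal.ofReal_mul hr1,
      ← ENNReal.ofReal_add (by positivity) (mul_nonneg hr1 (by linarith))]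
    congr 1
    ring
  rw [e1, e2]
  ring

theorem thinPoint_one (q : X → I) (hq : Measurable q) (h : ∀ x, q x = 1) :
    thinPoint q hq = Kernel.id := by
  refine kernel_ext_lintegral fun p f hf => ?_
  rw [lintegral_thinPoint _ _ _ hf, Kernel.id_apply, lintegral_dirac' _ hf, h]
  simp

/-- If the acceptance rate does not change along the transitions, `n` rounds of thinning and moving
amount to one thinning with rate `q ^ n`, followed by `n` moves. -/
theorem movePoint_comp_thinPoint_pow (T : Kernel X X) [IsMarkovKernel T] (q : X → I)
    (hq : Measurable q) (hinv : ∀ x, ∀ᵐ y ∂T x, q y = q x) (n : ℕ) :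
    (movePoint T ∘ₖ thinPoint q hq) ^ n =
      (movePoint T ^ n) ∘ₖ thinPoint (fun x => q x ^ n) (measurable_pow hq n) := by
  induction n with
  | zero =>
    rw [thinPoint_one _ _ fun x => pow_zero _, Kernel.comp_id]
    rfl
  | succ n ih =>
    have hinv' : ∀ x, ∀ᵐ y ∂T x, q y ^ n = q x ^ n := fun x => by
      filter_upwards [hinv x] with y hy
      rw [hy]
    have hthin : thinPoint (fun x => q x ^ n) (measurable_pow hq n) ∘ₖ thinPoint q hq =
        thinPoint (fun x => q x ^ (n + 1)) (measurable_pow hq (n + 1)) :=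
      thinPoint_comp_thinPoint _ _ (measurable_pow hq n) hq (measurable_pow hq (n + 1))
    rw [pow_succ, ih, pow_succ, ← hthin]
    change ((movePoint T ^ n) ∘ₖ thinPoint _ _) ∘ₖ (movePoint T ∘ₖ thinPoint q hq) =
      ((movePoint T ^ n) ∘ₖ movePoint T) ∘ₖ _
    rw [Kernel.comp_assoc, Kernel.comp_assoc]
    congr 1
    rw [← Kernel.comp_assoc, thinPoint_comp_movePoint T _ _ hinv', Kernel.comp_assoc]

/-- Under either alternative, the acceptance rate does not change along the transitions. -/
theorem rate_invariant {T : Kernel X X} {q : X → I} (hq : Measurable q)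
    (hqT : (∃ c : I, ∀ x, q x = c) ∨ T = Kernel.id) (x : X) : ∀ᵐ y ∂T x, q y = q x := by
  rcases hqT with ⟨c, hc⟩ | rfl
  · exact .of_forall fun y => by rw [hc, hc]
  · rw [Kernel.id_apply, ae_dirac_iff (measurableSet_eq_fun hq measurable_const)]

theorem transition_comp_subsample (T : Kernel X X) [IsMarkovKernel T] (q : X → I)
    (hq : Measurable q) :
    transition T ∘ₖ subsample q hq = piKernel fun _ : ℕ => movePoint T ∘ₖ thinPoint q hq :=
  piKernel_comp _ _

theorem transition_comp_subsample_pow (T : Kernel X X) [IsMarkovKernel T] (q : X → I)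
    (hq : Measurable q) (hinv : ∀ x, ∀ᵐ y ∂T x, q y = q x) (n : ℕ) :
    (transition T ∘ₖ subsample q hq) ^ n =
      (transition T ^ n) ∘ₖ subsample (fun x => q x ^ n) (measurable_pow hq n) := by
  rw [transition_comp_subsample, piKernel_pow, transition, piKernel_pow, subsample, piKernel_comp]
  simp_rw [movePoint_comp_thinPoint_pow T q hq hinv n]

end Points

/-! ### The function `exp (-x)` on `[0, ∞]` -/

section ExpNeg

open Filter Topology

/-- The function `x ↦ exp (-x)` on `[0, ∞]`, with value `0` at `∞`. -/
def expNeg (x : ℝ≥0∞) : ℝ≥0∞ := EReal.exp (-(x : EReal))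

/-- The function `y ↦ -log y` on `[0, 1]`, with value `∞` at `0`; it is truncated to `0` on
`[1, ∞]`. -/
def negLog (y : ℝ≥0∞) : ℝ≥0∞ := (-ENNReal.log y).toENNReal

@[simp] theorem expNeg_zero : expNeg 0 = 1 := by simp [expNeg]

@[simp] theorem expNeg_top : expNeg ∞ = 0 := by simp [expNeg]

theorem continuous_expNeg : Continuous expNeg :=
  ENNReal.continuous_exp.comp (continuous_neg.comp continuous_coe_ennreal_ereal)

theorem measurable_expNeg : Measurable expNeg := continuous_expNeg.measurable

theorem expNeg_le_one (x : ℝ≥0∞) : expNeg x ≤ 1 := by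
  rw [expNeg, EReal.exp_le_one_iff, EReal.neg_le, neg_zero]
  exact EReal.coe_ennreal_nonneg x

theorem expNeg_ne_top (x : ℝ≥0∞) : expNeg x ≠ ∞ := ((expNeg_le_one x).trans_lt (by simp)).ne

theorem expNeg_strictAnti : StrictAnti expNeg := fun _ _ h =>
  EReal.exp_strictMono (EReal.neg_lt_neg_iff.2 (EReal.coe_ennreal_lt_coe_ennreal_iff.2 h))

theorem expNeg_antitone : Antitone expNeg := expNeg_strictAnti.antitone

theorem expNeg_injective : Function.Injective expNeg := expNeg_strictAnti.injective

theorem expNeg_add (x y : ℝ≥0∞) : expNeg (x + y) = expNeg x * expNeg y := by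
  have hne : ∀ z : ℝ≥0∞, EReal.exp z ≠ 0 := fun z => by simp
  simp only [expNeg, EReal.exp_neg]
  rw [EReal.coe_ennreal_add, EReal.exp_add, ENNReal.mul_inv (.inl (hne x)) (.inr (hne y))]

theorem expNeg_sum {ι : Type*} (s : Finset ι) (f : ι → ℝ≥0∞) :
    expNeg (∑ i ∈ s, f i) = ∏ i ∈ s, expNeg (f i) := by
  classical
  induction s using Finset.induction_on with
  | empty => simp
  | insert i s hi ih => rw [Finset.sum_insert hi, Finset.prod_insert hi, expNeg_add, ih]

theorem expNeg_nat_mul (n : ℕ) (x : ℝ≥0∞) : expNeg (n * x) = expNeg x ^ n := by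
  rw [← nsmul_eq_mul, ← Finset.card_range n, ← Finset.sum_const, expNeg_sum, Finset.prod_const]

theorem expNeg_coe (r : ℝ≥0) : expNeg r = ENNReal.ofReal (Real.exp (-r)) := by
  rw [expNeg, EReal.coe_nnreal_eq_coe_real, ← EReal.coe_neg, EReal.exp_coe]

theorem expNeg_negLog {y : ℝ≥0∞} (hy : y ≤ 1) : expNeg (negLog y) = y := by
  rw [expNeg, negLog, EReal.coe_toENNReal, neg_neg, ENNReal.exp_log]
  rw [EReal.le_neg, neg_zero]
  exact ENNReal.log_le_zero_iff.2 hy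

@[simp] theorem negLog_one : negLog 1 = 0 := by simp [negLog]

theorem measurable_negLog : Measurable negLog :=
  (measurable_neg.comp ENNReal.measurable_log).ereal_toENNReal

theorem tendsto_prod_expNeg (f : ℕ → ℝ≥0∞) :
    Tendsto (fun n => ∏ k ∈ Finset.range n, expNeg (f k)) atTop (𝓝 (expNeg (∑' k, f k))) := by
  simp_rw [← expNeg_sum]
  exact (continuous_expNeg.tendsto _).comp (ENNReal.tendsto_nat_tsum f)

theorem one_sub_expNeg_le (x : ℝ≥0∞) : 1 - expNeg x ≤ x := by
  induction x with
  | top => simp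
  | coe r =>
    rw [tsub_le_iff_right, expNeg_coe, ← ENNReal.ofReal_coe_nnreal, ← ENNReal.ofReal_one,
      ← ENNReal.ofReal_add r.coe_nonneg (Real.exp_nonneg _)]
    refine ENNReal.ofReal_le_ofReal ?_
    have := Real.add_one_le_exp (-(r : ℝ))
    linarith

theorem one_sub_expNeg_eq_zero {x : ℝ≥0∞} : 1 - expNeg x = 0 ↔ x = 0 := by
  rw [tsub_eq_zero_iff_le]
  refine ⟨fun h => ?_, fun h => by simp [h]⟩
  refine expNeg_injective ?_
  rw [expNeg_zero]
  exact le_antisymm (expNeg_le_one x) h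

end ExpNeg

/-! ### Laplace functionals determine laws of random measures -/

section Uniqueness

/-- The bounded continuous function `x ↦ exp (-x i)` on `[0, ∞]^ι`. -/
def expNegCoord {ι : Type*} (i : ι) : BoundedContinuousFunction (ι → ℝ≥0∞) ℝ :=
  BoundedContinuousFunction.ofNormedAddCommGroup (fun x => (expNeg (x i)).toReal)
    (ENNReal.continuousOn_toReal.comp_continuous
      (continuous_expNeg.comp (continuous_apply i)) fun x => expNeg_ne_top _) 1 fun x => by
    rw [Real.norm_of_nonneg ENNReal.toReal_nonneg]
    exact ENNReal.toReal_le_of_le_ofReal zero_le_one (by simpa using expNeg_le_one _)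

theorem expNegCoord_apply {ι : Type*} (i : ι) (x : ι → ℝ≥0∞) :
    expNegCoord i x = (expNeg (x i)).toReal := rfl

/-- A finite measure on `[0, ∞]^ι` is determined by its Laplace transform at integer points: the
polynomials in the functions `exp (-x i)` form an algebra that separates points. -/
theorem ext_of_laplace_pi {ι : Type*} [Fintype ι] {μ ν : Measure (ι → ℝ≥0∞)}
    [IsFiniteMeasure μ] [IsFiniteMeasure ν]
    (h : ∀ k : ι → ℕ, ∫⁻ x, expNeg (∑ i, k i * x i) ∂μ = ∫⁻ x, expNeg (∑ i, k i * x i) ∂ν) :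
    μ = ν := by
  -- Over `ℝ` the star operation is trivial, so every subalgebra is a star subalgebra.
  let A : StarSubalgebra ℝ (BoundedContinuousFunction (ι → ℝ≥0∞) ℝ) :=
    { Algebra.adjoin ℝ (Set.range expNegCoord) with
      star_mem' := fun {a} ha => by
        have : star a = a := by ext x; simp
        rwa [this] }
  refine ext_of_forall_mem_subalgebra_integral_eq_of_polish (𝕜 := ℝ) (A := A) ?_ ?_
  · intro x y hxy
    obtain ⟨i, hi⟩ := Function.ne_iff.1 hxy
    refine ⟨_, ⟨(expNegCoord i).toContinuousMap, ⟨expNegCoord i, ?_, rfl⟩, rfl⟩, ?_⟩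
    · exact Algebra.subset_adjoin ⟨i, rfl⟩
    · intro he
      change (expNeg (x i)).toReal = (expNeg (y i)).toReal at he
      rw [ENNReal.toReal_eq_toReal_iff' (expNeg_ne_top _) (expNeg_ne_top _)] at he
      exact hi (expNeg_injective he)
  · intro g hg
    have hg' : g ∈ Submodule.span ℝ
        (Submonoid.closure (Set.range (expNegCoord (ι := ι))) : Set _) := by
      rw [← Algebra.adjoin_eq_span]
      exact hg
    clear hg
    induction hg' using Submodule.span_induction with
    | mem g hg =>
      -- A product of coordinate functions is `exp (-∑ i, k i * x i)` for some exponents `k`.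
      have hk : ∃ k : ι → ℕ, ∀ x, g x = (expNeg (∑ i, k i * x i)).toReal := by
        classical
        induction hg using Submonoid.closure_induction with
        | mem g hg =>
          obtain ⟨i, rfl⟩ := hg
          refine ⟨Pi.single i 1, fun x => ?_⟩
          rw [expNegCoord_apply, Finset.sum_eq_single i] <;> simp +contextual
        | one => exact ⟨0, fun x => by simp⟩
        | mul f g _ _ hf hg =>
          obtain ⟨k, hk⟩ := hf
          obtain ⟨l, hl⟩ := hg
          refine ⟨k + l, fun x => ?_⟩
          rw [BoundedContinuousFunction.mul_apply, hk, hl, ← ENNReal.toReal_mul, ← expNeg_add,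
            ← Finset.sum_add_distrib]
          simp [add_mul]
      obtain ⟨k, hk⟩ := hk
      simp_rw [hk]
      have hm : Measurable fun x : ι → ℝ≥0∞ => expNeg (∑ i, k i * x i) :=
        measurable_expNeg.comp (by fun_prop)
      rw [integral_toReal hm.aemeasurable (.of_forall fun x => (expNeg_ne_top _).lt_top),
        integral_toReal hm.aemeasurable (.of_forall fun x => (expNeg_ne_top _).lt_top), h]
    | zero => simp
    | add f g _ _ hf hg =>
      simp only [BoundedContinuousFunction.add_apply]
      rw [integral_add (f.integrable _) (g.integrable _),
        integral_add (f.integrable _) (g.integrable _), hf, hg]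
    | smul c f _ hf =>
      simp only [BoundedContinuousFunction.smul_apply, integral_smul]
      rw [hf]

variable {X : Type*} [MeasurableSpace X]

/-- The law of a random measure is determined by its Laplace functional. -/
theorem ext_of_laplace {μ ν : Measure (Measure X)} [IsFiniteMeasure μ] [IsFiniteMeasure ν]
    (h : ∀ f : X → ℝ≥0, Measurable f →
      ∫⁻ M, expNeg (∫⁻ x, f x ∂M) ∂μ = ∫⁻ M, expNeg (∫⁻ x, f x ∂M) ∂ν) : μ = ν := by
  let Φ : Measure X → ({A : Set X // MeasurableSet A} → ℝ≥0∞) := fun M A => M A.1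
  have hΦ : Measurable Φ := measurable_pi_lambda _ fun A => Measure.measurable_coe A.2
  have hgen : (inferInstance : MeasurableSpace (Measure X)) ≤
      MeasurableSpace.comap Φ inferInstance := by
    refine iSup₂_le fun s hs => ?_
    have : (fun M : Measure X => M s) = (fun x => x ⟨s, hs⟩) ∘ Φ := rfl
    rw [this, ← BorelSpace.measurable_eq, ← MeasurableSpace.comap_comp]
    exact MeasurableSpace.comap_mono (measurable_pi_apply _).comap_le
  -- The finite-dimensional marginals agree: their Laplace transforms at integer points are the
  -- Laplace functionals of integer combinations of indicator functions.
  have key : μ.map Φ = ν.map Φ := by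
    refine IsProjectiveLimit.unique (P := fun J => (ν.map Φ).map J.restrict) ?_ fun _ => rfl
    intro J
    change (μ.map Φ).map J.restrict = (ν.map Φ).map J.restrict
    refine ext_of_laplace_pi fun k => ?_
    have hm : Measurable fun x : J → ℝ≥0∞ => expNeg (∑ i, k i * x i) :=
      measurable_expNeg.comp (by fun_prop)
    rw [Measure.map_map (by fun_prop) hΦ, Measure.map_map (by fun_prop) hΦ,
      lintegral_map hm (by fun_prop), lintegral_map hm (by fun_prop)]
    have hf : Measurable fun x : X => ∑ i : J, (k i : ℝ≥0) * (i.1.1).indicator (fun _ => 1) x :=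
      Finset.measurable_sum _ fun i _ => (measurable_const.indicator i.1.2).const_mul _
    have hM : ∀ M : Measure X, ∑ i : J, (k i : ℝ≥0∞) * M i.1.1 =
        ∫⁻ x, ((∑ i : J, (k i : ℝ≥0) * (i.1.1).indicator (fun _ => 1) x : ℝ≥0) : ℝ≥0∞) ∂M := by
      intro M
      simp_rw [ENNReal.ofNNReal_finsetSum, ENNReal.coe_mul, ENNReal.coe_indicator]
      rw [lintegral_finsetSum _ fun i _ => (measurable_const.indicator i.1.2).const_mul _]
      refine Finset.sum_congr rfl fun i _ => ?_
      rw [lintegral_const_mul _ (measurable_const.indicator i.1.2),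
        lintegral_indicator_const i.1.2]
      simp
    have hfin := h _ hf
    simp_rw [← hM] at hfin
    exact hfin
  ext s hs
  obtain ⟨B, hB, rfl⟩ := hgen s hs
  rw [← Measure.map_apply hΦ hB, ← Measure.map_apply hΦ hB, key]

end Uniqueness

/-! ### The Laplace functional of a Poisson process -/

section Laplace

open Filter Topology

theorem lintegral_expNeg_poissonMeasure (c : ℝ≥0∞) (r : ℝ≥0) :
    ∫⁻ n : ℕ, expNeg (c * n) ∂poissonMeasure r = expNeg ((1 - expNeg c) * r) := by
  obtain ⟨a, ha⟩ : ∃ a : ℝ≥0, (a : ℝ≥0∞) = expNeg c :=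
    ⟨_, ENNReal.coe_toNNReal (expNeg_ne_top c)⟩
  have ha1 : a ≤ 1 := by
    have := expNeg_le_one c
    rwa [← ha, ENNReal.coe_le_one_iff] at this
  have hs : HasSum (fun n : ℕ => Real.exp (-r) * ((a * r : ℝ) ^ n / n.factorial))
      (Real.exp (-r) * Real.exp (a * r)) := by
    rw [Real.exp_eq_exp_ℝ]
    exact (NormedSpace.expSeries_div_hasSum_exp (a * r : ℝ)).mul_left _
  have hterm : ∀ n : ℕ, ENNReal.ofReal (Real.exp (-r) * r ^ n / n.factorial) * expNeg (c * n) =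
      ENNReal.ofReal (Real.exp (-r) * ((a * r : ℝ) ^ n / n.factorial)) := by
    intro n
    rw [mul_comm c, expNeg_nat_mul, ← ha, ← ENNReal.coe_pow, ← ENNReal.ofReal_coe_nnreal,
      ← ENNReal.ofReal_mul (by positivity)]
    congr 1
    push_cast
    ring
  rw [poissonMeasure, lintegral_sum_measure]
  simp_rw [lintegral_smul_measure, lintegral_dirac, smul_eq_mul, hterm]
  rw [← ENNReal.ofReal_tsum_of_nonneg (fun n => by positivity) hs.summable, hs.tsum_eq, ← ha,
    ← ENNReal.coe_one, ← ENNReal.coe_sub, ← ENNReal.coe_mul, expNeg_coe, ← Real.exp_add]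
  congr 2
  rw [NNReal.coe_mul, NNReal.coe_sub ha1]
  push_cast
  ring

variable {X : Type*} [MeasurableSpace X]

theorem lintegral_pointCount (c : Config X) {g : ℝ≥0 × X → ℝ≥0∞} (hg : Measurable g) :
    ∫⁻ p, g p ∂pointCount c = ∑' k, if 0 < (c k).1 then g (c k) else 0 := by
  rw [pointCount, lintegral_sum_measure]
  refine tsum_congr fun k => ?_
  split_ifs
  · rw [lintegral_dirac' _ hg]
  · simp

theorem measurable_lintegral_pointCount {g : ℝ≥0 × X → ℝ≥0∞} (hg : Measurable g) :
    Measurable fun c : Config X => ∫⁻ p, g p ∂pointCount c := by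
  simp_rw [lintegral_pointCount _ hg]
  refine Measurable.tsum fun k => ?_
  exact Measurable.ite (measurableSet_lt measurable_const (by fun_prop)) (by fun_prop)
    measurable_const

theorem measurable_pointCount_apply {A : Set (ℝ≥0 × X)} (hA : MeasurableSet A) :
    Measurable fun c : Config X => pointCount c A := by
  have h := measurable_lintegral_pointCount (X := X)
    (measurable_const (a := (1 : ℝ≥0∞)) |>.indicator hA)
  simpa [lintegral_indicator_const hA] using h

variable {Ω : Type*} [MeasurableSpace Ω] {P : Measure Ω} {π : Ω → Config X}
  {ν : Measure (ℝ≥0 × X)}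

theorem IsPoisson.lintegral_expNeg_mul_apply [IsProbabilityMeasure P] (h : IsPoisson P π ν)
    {A : Set (ℝ≥0 × X)} (hA : MeasurableSet A) (c : ℝ≥0∞) :
    ∫⁻ ω, expNeg (c * pointCount (π ω) A) ∂P = expNeg ((1 - expNeg c) * ν A) := by
  by_cases hν : ν A = ∞
  · by_cases hc : c = 0
    · simp [hc]
    · have h1 : ∀ᵐ ω ∂P, expNeg (c * pointCount (π ω) A) = 0 := by
        filter_upwards [h.poisson_top A hA hν] with ω hω
        rw [hω, ENNReal.mul_top hc, expNeg_top]
      rw [lintegral_congr_ae h1, hν, ENNReal.mul_top (mt one_sub_expNeg_eq_zero.1 hc), expNeg_top,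
        lintegral_zero]
  · have hm : Measurable fun x : ℝ≥0∞ => expNeg (c * x) :=
      measurable_expNeg.comp (measurable_id.const_mul c)
    rw [(h.poisson A hA hν).lintegral_comp (f := fun x => expNeg (c * x)) hm.aemeasurable,
      lintegral_map hm .of_discrete, lintegral_expNeg_poissonMeasure, ENNReal.coe_toNNReal hν]

theorem IsPoisson.laplace_simpleFunc [IsProbabilityMeasure P] (h : IsPoisson P π ν)
    (φ : SimpleFunc (ℝ≥0 × X) ℝ≥0∞) :
    ∫⁻ ω, expNeg (∫⁻ p, φ p ∂pointCount (π ω)) ∂P = expNeg (∫⁻ p, (1 - expNeg (φ p)) ∂ν) := by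
  -- Only the fibres of `φ` matter; enumerate them as disjoint sets indexed by `Fin n`.
  let e := φ.range.equivFin.symm
  let A : Fin φ.range.card → Set (ℝ≥0 × X) := fun i => φ ⁻¹' {(e i : ℝ≥0∞)}
  have hA : ∀ i, MeasurableSet (A i) := fun i => φ.measurableSet_fiber _
  have hdisj : Pairwise fun i j => Disjoint (A i) (A j) := fun i j hij =>
    Disjoint.preimage _ (Set.disjoint_singleton.2 fun he => hij (e.injective (Subtype.ext he)))
  have hreindex : ∀ F : ℝ≥0∞ → ℝ≥0∞, ∑ y ∈ φ.range, F y = ∑ i, F (e i) := fun F => by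
    rw [← Finset.sum_coe_sort, ← e.sum_comp]
  have hL : ∀ N : Measure (ℝ≥0 × X), ∫⁻ p, φ p ∂N = ∑ i, (e i : ℝ≥0∞) * N (A i) := fun N => by
    rw [SimpleFunc.lintegral_eq_lintegral, SimpleFunc.lintegral,
      hreindex fun y => y * N (φ ⁻¹' {y})]
  have hR : ∫⁻ p, (1 - expNeg (φ p)) ∂ν = ∑ i, (1 - expNeg (e i)) * ν (A i) := by
    have : ∀ p, 1 - expNeg (φ p) = (φ.map fun y => 1 - expNeg y) p := fun p => rfl
    simp_rw [this]
    rw [SimpleFunc.lintegral_eq_lintegral, SimpleFunc.map_lintegral,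
      hreindex fun y => (1 - expNeg y) * ν (φ ⁻¹' {y})]
  simp_rw [hL, hR, expNeg_sum]
  have hm : ∀ i, Measurable fun x : ℝ≥0∞ => expNeg (e i * x) := fun i =>
    measurable_expNeg.comp (measurable_id.const_mul _)
  rw [lintegral_prod_eq_prod_lintegral_of_indepFun Finset.univ
    (fun i ω => expNeg (e i * pointCount (π ω) (A i)))
    ((h.indep _ A hA hdisj).comp (fun i x => expNeg (e i * x)) hm)
    fun i => (hm i).comp ((measurable_pointCount_apply (hA i)).comp h.measurable)]
  exact Finset.prod_congr rfl fun i _ => h.lintegral_expNeg_mul_apply (hA i) _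

/-- The Laplace functional of a Poisson process with mean measure `ν`. -/
theorem IsPoisson.laplace [IsProbabilityMeasure P] (h : IsPoisson P π ν)
    {g : ℝ≥0 × X → ℝ≥0∞} (hg : Measurable g) :
    ∫⁻ ω, expNeg (∫⁻ p, g p ∂pointCount (π ω)) ∂P = expNeg (∫⁻ p, (1 - expNeg (g p)) ∂ν) := by
  have hmono : ∀ p, Monotone fun n => SimpleFunc.eapprox g n p := fun p _ _ hnm =>
    SimpleFunc.monotone_eapprox g hnm p
  have hL : Tendsto (fun n => ∫⁻ ω, expNeg (∫⁻ p, SimpleFunc.eapprox g n p ∂pointCount (π ω)) ∂P)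
      atTop (𝓝 (∫⁻ ω, expNeg (∫⁻ p, g p ∂pointCount (π ω)) ∂P)) := by
    refine tendsto_lintegral_of_dominated_convergence (fun _ => 1) (fun n => ?_)
      (fun n => .of_forall fun ω => expNeg_le_one _) (by simp) (.of_forall fun ω => ?_)
    · exact measurable_expNeg.comp ((measurable_lintegral_pointCount
        (SimpleFunc.eapprox g n).measurable).comp h.measurable)
    · refine (continuous_expNeg.tendsto _).comp (lintegral_tendsto_of_tendsto_of_monotone
        (fun n => (SimpleFunc.eapprox g n).measurable.aemeasurable) (.of_forall hmono)
        (.of_forall fun p => SimpleFunc.tendsto_eapprox hg p))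
  have hR : Tendsto (fun n => expNeg (∫⁻ p, (1 - expNeg (SimpleFunc.eapprox g n p)) ∂ν))
      atTop (𝓝 (expNeg (∫⁻ p, (1 - expNeg (g p)) ∂ν))) := by
    refine (continuous_expNeg.tendsto _).comp (lintegral_tendsto_of_tendsto_of_monotone
      (fun n => ?_) (.of_forall fun p _ _ hnm => ?_) (.of_forall fun p => ?_))
    · exact (measurable_const.sub
        (measurable_expNeg.comp (SimpleFunc.eapprox g n).measurable)).aemeasurable
    · exact tsub_le_tsub_left (expNeg_antitone (hmono p hnm)) _
    · exact ENNReal.Tendsto.sub tendsto_const_nhds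
        ((continuous_expNeg.tendsto _).comp (SimpleFunc.tendsto_eapprox hg p)) (.inl (by simp))
  simp_rw [h.laplace_simpleFunc] at hL
  exact tendsto_nhds_unique hL hR

theorem totalMass_eq_lintegral (c : Config X) :
    totalMass c = ∫⁻ p, (p.1 : ℝ≥0∞) ∂pointCount c := by
  rw [lintegral_pointCount c (by fun_prop), totalMass]
  refine tsum_congr fun k => ?_
  split_ifs with hk
  · rfl
  · simpa using hk

/-- If the mean measure has finite mean total mass, the total mass is finite almost surely:
its Laplace transform at `s` tends to `1` as `s` tends to `0`. -/
theorem IsPoisson.totalMass_lt_top [IsProbabilityMeasure P] (h : IsPoisson P π ν)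
    (hν : ∫⁻ p, (p.1 : ℝ≥0∞) ∂ν ≠ ∞) : ∀ᵐ ω ∂P, totalMass (π ω) < ∞ := by
  have hmeas : MeasurableSet {ω | totalMass (π ω) < ∞} :=
    measurableSet_lt (measurable_totalMass.comp h.measurable) measurable_const
  have hle : ∀ n : ℕ, expNeg (((n : ℝ≥0∞) + 1)⁻¹ * ∫⁻ p, (p.1 : ℝ≥0∞) ∂ν) ≤
      P {ω | totalMass (π ω) < ∞} := by
    intro n
    have hs : ((n : ℝ≥0∞) + 1)⁻¹ ≠ 0 := by simp
    have hg : Measurable fun p : ℝ≥0 × X => ((n : ℝ≥0∞) + 1)⁻¹ * (p.1 : ℝ≥0∞) := by fun_prop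
    calc expNeg (((n : ℝ≥0∞) + 1)⁻¹ * ∫⁻ p, (p.1 : ℝ≥0∞) ∂ν)
        ≤ expNeg (∫⁻ p, (1 - expNeg (((n : ℝ≥0∞) + 1)⁻¹ * p.1)) ∂ν) := by
          refine expNeg_antitone ?_
          rw [← lintegral_const_mul _ (by fun_prop)]
          exact lintegral_mono fun p => one_sub_expNeg_le _
      _ = ∫⁻ ω, expNeg (((n : ℝ≥0∞) + 1)⁻¹ * totalMass (π ω)) ∂P := by
          rw [← h.laplace hg]
          refine lintegral_congr fun ω => ?_
          rw [lintegral_const_mul _ (by fun_prop), totalMass_eq_lintegral]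
      _ ≤ ∫⁻ ω, {ω | totalMass (π ω) < ∞}.indicator (fun _ => 1) ω ∂P := by
          refine lintegral_mono fun ω => ?_
          by_cases hω : totalMass (π ω) < ∞
          · rw [Set.indicator_of_mem (by exact hω)]
            exact expNeg_le_one _
          · rw [not_lt_top_iff.1 hω, ENNReal.mul_top hs, expNeg_top]
            exact zero_le
      _ = P {ω | totalMass (π ω) < ∞} := by simp [lintegral_indicator_const hmeas]
  have hlim : Tendsto (fun n : ℕ => expNeg (((n : ℝ≥0∞) + 1)⁻¹ * ∫⁻ p, (p.1 : ℝ≥0∞) ∂ν)) atTop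
      (𝓝 1) := by
    rw [← expNeg_zero, ← zero_mul (∫⁻ p, (p.1 : ℝ≥0∞) ∂ν)]
    refine (continuous_expNeg.tendsto _).comp (ENNReal.Tendsto.mul_const ?_ (.inr hν))
    have := (tendsto_add_atTop_iff_nat 1).2 ENNReal.tendsto_inv_nat_nhds_zero
    simpa using this
  have h1 : P {ω | totalMass (π ω) < ∞} = 1 :=
    le_antisymm prob_le_one (le_of_tendsto' hlim hle)
  exact (prob_compl_eq_zero_iff hmeas).2 h1

/-- The Laplace functional of a sequence of independent points, as an exponential of a sum. -/
theorem lintegral_expNeg_tsum_piKernel {α β : Type*} [MeasurableSpace α] [MeasurableSpace β]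
    (κ : Kernel α β) [IsMarkovKernel κ] {h : β → ℝ≥0∞} (hh : Measurable h) (c : ℕ → α) :
    ∫⁻ w, expNeg (∑' k, h (w k)) ∂(piKernel fun _ : ℕ => κ) c =
      expNeg (∑' k, negLog (∫⁻ b, expNeg (h b) ∂κ (c k))) := by
  have hm : Measurable fun b => expNeg (h b) := measurable_expNeg.comp hh
  have hL : Tendsto (fun n => ∫⁻ w, ∏ k ∈ Finset.range n, expNeg (h (w k))
      ∂(piKernel fun _ : ℕ => κ) c) atTop
      (𝓝 (∫⁻ w, expNeg (∑' k, h (w k)) ∂(piKernel fun _ : ℕ => κ) c)) := by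
    refine tendsto_lintegral_of_dominated_convergence (fun _ => 1) (fun n => ?_)
      (fun n => .of_forall fun w => Finset.prod_le_one' fun k _ => expNeg_le_one _) (by simp)
      (.of_forall fun w => tendsto_prod_expNeg _)
    exact Finset.measurable_prod _ fun k _ => hm.comp (measurable_pi_apply k)
  have hle : ∀ a, ∫⁻ b, expNeg (h b) ∂κ a ≤ 1 := fun a => by
    calc ∫⁻ b, expNeg (h b) ∂κ a ≤ ∫⁻ _, 1 ∂κ a := lintegral_mono fun b => expNeg_le_one _
      _ = 1 := by simp
  refine tendsto_nhds_unique hL ((tendsto_prod_expNeg _).congr fun n => ?_)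
  rw [piKernel_apply, lintegral_infinitePi_finset_prod _ _ fun _ => hm]
  exact Finset.prod_congr rfl fun k _ => expNeg_negLog (hle _)

theorem lintegral_toMeasure (c : Config X) {f : X → ℝ≥0∞} (hf : Measurable f) :
    ∫⁻ x, f x ∂toMeasure c = ∑' k, (c k).1 * f (c k).2 := by
  rw [toMeasure, lintegral_sum_measure]
  simp_rw [lintegral_smul_measure, lintegral_dirac' _ hf, smul_eq_mul]

/-- The Laplace functional of the random measure obtained by moving the points of a Poisson process
independently, where points of weight `0` keep the weight `0`. -/
theorem IsPoisson.laplace_piKernel [IsProbabilityMeasure P] (h : IsPoisson P π ν)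
    (κ : Kernel (ℝ≥0 × X) (ℝ≥0 × X)) [IsMarkovKernel κ]
    (hκ : ∀ x, ∀ᵐ z ∂κ (0, x), z.1 = 0) {f : X → ℝ≥0} (hf : Measurable f) :
    ∫⁻ w, expNeg (∫⁻ x, f x ∂toMeasure w) ∂((piKernel fun _ : ℕ => κ) ∘ₘ P.map π) =
      expNeg (∫⁻ p, (1 - ∫⁻ z, expNeg (z.1 * f z.2) ∂κ p) ∂ν) := by
  have hF : Measurable fun z : ℝ≥0 × X => (z.1 : ℝ≥0∞) * f z.2 := by fun_prop
  have hE : Measurable fun z : ℝ≥0 × X => expNeg (z.1 * f z.2) := measurable_expNeg.comp hF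
  have hf' : Measurable fun x => (f x : ℝ≥0∞) := by fun_prop
  have hle : ∀ p, ∫⁻ z, expNeg (z.1 * f z.2) ∂κ p ≤ 1 := fun p => by
    calc ∫⁻ z, expNeg (z.1 * f z.2) ∂κ p ≤ ∫⁻ _, 1 ∂κ p := lintegral_mono fun b => expNeg_le_one _
      _ = 1 := by simp
  let g : ℝ≥0 × X → ℝ≥0∞ := fun p => negLog (∫⁻ z, expNeg (z.1 * f z.2) ∂κ p)
  have hg : Measurable g := measurable_negLog.comp hE.lintegral_kernel
  have hg0 : ∀ x, g (0, x) = 0 := fun x => by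
    have : ∫⁻ z, expNeg (z.1 * f z.2) ∂κ (0, x) = ∫⁻ _, 1 ∂κ (0, x) := by
      refine lintegral_congr_ae ?_
      filter_upwards [hκ x] with z hz
      simp [hz]
    simp [g, this]
  have hgc : ∀ c : Config X, ∫⁻ p, g p ∂pointCount c = ∑' k, g (c k) := fun c => by
    rw [lintegral_pointCount c hg]
    refine tsum_congr fun k => ?_
    split_ifs with hk
    · rfl
    · have : c k = (0, (c k).2) := Prod.ext (by simpa using hk) rfl
      rw [this, hg0]
  have hW : Measurable fun w : Config X => expNeg (∫⁻ x, f x ∂toMeasure w) := by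
    simp_rw [lintegral_toMeasure _ hf']
    exact measurable_expNeg.comp (Measurable.tsum fun k => by fun_prop)
  rw [Measure.lintegral_bind (Kernel.aemeasurable _) hW.aemeasurable,
    lintegral_map hW.lintegral_kernel h.measurable]
  have hstep : ∀ ω, ∫⁻ w, expNeg (∫⁻ x, f x ∂toMeasure w) ∂(piKernel fun _ : ℕ => κ) (π ω) =
      expNeg (∫⁻ p, g p ∂pointCount (π ω)) := fun ω => by
    simp_rw [lintegral_toMeasure _ hf', hgc]
    exact lintegral_expNeg_tsum_piKernel κ hF (π ω)
  simp_rw [hstep]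
  rw [h.laplace hg]
  simp_rw [g, expNeg_negLog (hle _)]

end Laplace

/-! ### Total masses, scaling and superposition -/

section ConfigFacts

variable {X : Type*}

theorem scale_scale (a b : ℝ≥0) (c : Config X) : scale a (scale b c) = scale (a * b) c := by
  funext k
  simp [scale, mul_assoc]

theorem scale_superpose (a : ℝ≥0) (c d : Config X) :
    scale a (superpose c d) = superpose (scale a c) (scale a d) := by
  funext k
  unfold scale superpose
  rcases Equiv.natSumNatEquivNat.symm k with i | i <;> rfl

theorem weight_eq_zero_of_totalMass_eq_zero {c : Config X} (h : totalMass c = 0) (k : ℕ) :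
    (c k).1 = 0 := by
  have := ENNReal.tsum_eq_zero.1 h k
  simpa using this

theorem scale_eq_of_totalMass_eq_zero {c : Config X} (h : totalMass c = 0) (a b : ℝ≥0) :
    scale a c = scale b c := by
  funext k
  simp [scale, weight_eq_zero_of_totalMass_eq_zero h k]

theorem scale_one (c : Config X) : scale 1 c = c := by
  funext k
  simp [scale]

/-- The weights and the total mass of a normalised random measure determine the unnormalised one. -/
theorem scale_toNRM {c : Config X} (h : totalMass c < ∞) : scale (toNRM c).2 (toNRM c).1 = c := by
  simp only [toNRM, renormalize, one_mul, scale_scale]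
  by_cases h0 : totalMass c = 0
  · rw [scale_eq_of_totalMass_eq_zero h0 _ 1, scale_one]
  · rw [mul_inv_cancel₀ (ENNReal.toNNReal_ne_zero.2 ⟨h0, h.ne⟩), scale_one]

variable [MeasurableSpace X]

theorem toMeasure_univ (c : Config X) : toMeasure c Set.univ = totalMass c := by
  rw [toMeasure, Measure.sum_apply _ MeasurableSet.univ, totalMass]
  simp

theorem toMeasure_superpose (c d : Config X) :
    toMeasure (superpose c d) = toMeasure c + toMeasure d := by
  ext s hs
  rw [Measure.add_apply, toMeasure, toMeasure, toMeasure, Measure.sum_apply _ hs,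
    Measure.sum_apply _ hs, Measure.sum_apply _ hs, ← Equiv.natSumNatEquivNat.tsum_eq,
    Summable.tsum_sum ENNReal.summable ENNReal.summable]
  simp [superpose]

theorem totalMass_superpose (c d : Config X) :
    totalMass (superpose c d) = totalMass c + totalMass d := by
  simp_rw [← toMeasure_univ, toMeasure_superpose, Measure.add_apply]

theorem toMeasure_scale (a : ℝ≥0) (c : Config X) :
    toMeasure (scale a c) = (a : ℝ≥0∞) • toMeasure c := by
  ext s hs
  rw [Measure.smul_apply, toMeasure, toMeasure, Measure.sum_apply _ hs, Measure.sum_apply _ hs,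
    smul_eq_mul, ← ENNReal.tsum_mul_left]
  simp [scale, mul_assoc]

theorem totalMass_scale (a : ℝ≥0) (c : Config X) :
    totalMass (scale a c) = a * totalMass c := by
  simp_rw [← toMeasure_univ, toMeasure_scale, Measure.smul_apply, smul_eq_mul]

theorem toMeasure_toNRM (c : Config X) : toMeasure (toNRM c).1 = normalize (toMeasure c) := by
  simp only [toNRM, renormalize, toMeasure_scale, normalize, toMeasure_univ]
  by_cases h0 : totalMass c = 0
  · have : toMeasure c = 0 := by
      rw [← Measure.measure_univ_eq_zero, toMeasure_univ, h0]
    simp [this]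
  by_cases ht : totalMass c = ∞
  · simp [ht]
  · rw [ENNReal.coe_inv (ENNReal.toNNReal_ne_zero.2 ⟨h0, ht⟩), ENNReal.coe_toNNReal ht]

/-- Superposition commutes with normalisation, as the total masses are carried along. -/
theorem superposeNRM_toNRM {c d : Config X} (hc : totalMass c < ∞) (hd : totalMass d < ∞) :
    superposeNRM (toNRM c) (toNRM d) = toNRM (superpose c d) := by
  have hsum : (totalMass c + totalMass d).toNNReal =
      (totalMass c).toNNReal + (totalMass d).toNNReal := ENNReal.toNNReal_add hc.ne hd.ne
  have key : ∀ (e : Config X), totalMass e < ∞ → ∀ s : ℝ≥0,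
      scale ((totalMass e).toNNReal / s) (scale (totalMass e).toNNReal⁻¹ e) = scale s⁻¹ e := by
    intro e he s
    rw [scale_scale]
    by_cases h0 : totalMass e = 0
    · exact scale_eq_of_totalMass_eq_zero h0 _ _
    · rw [div_mul_eq_mul_div, mul_inv_cancel₀ (ENNReal.toNNReal_ne_zero.2 ⟨h0, he.ne⟩), one_div]
  simp only [superposeNRM, toNRM, renormalize, one_mul, totalMass_superpose, hsum,
    scale_superpose, key c hc, key d hd]

/-- Renormalisation after scaling by the inverse total mass of `c` is normalisation. The mass of `w`
is bounded by that of `c`, so that no positive weight is lost when `c` has mass `0`. -/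
theorem renormalize_scale {c w : Config X} (hc : totalMass c < ∞) (hw : totalMass w ≤ totalMass c) :
    renormalize (scale (totalMass c).toNNReal⁻¹ w, (totalMass c).toNNReal) = toNRM w := by
  simp only [toNRM, renormalize, totalMass_scale, scale_scale, one_mul, ENNReal.toNNReal_mul,
    ENNReal.toNNReal_coe, mul_inv, inv_inv]
  by_cases h0 : totalMass w = 0
  · simp only [h0, ENNReal.toNNReal_zero, mul_zero]
    rw [scale_eq_of_totalMass_eq_zero h0]
  · have hc0 : (totalMass c).toNNReal ≠ 0 :=
      ENNReal.toNNReal_ne_zero.2 ⟨fun h => h0 (le_zero_iff.1 (h ▸ hw)), hc.ne⟩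
    rw [← mul_assoc, mul_inv_cancel₀ hc0, one_mul, mul_right_comm, mul_inv_cancel₀ hc0, one_mul]

theorem measurableSet_totalMass_lt_top : MeasurableSet {c : Config X | totalMass c < ∞} :=
  measurableSet_lt measurable_totalMass measurable_const

theorem measurableSet_forall_totalMass_lt_top :
    MeasurableSet {c : ℕ → Config X | ∀ j, totalMass (c j) < ∞} := by
  rw [Set.ofPred_forall]
  exact MeasurableSet.iInter fun j => measurableSet_lt
    (measurable_totalMass.comp (measurable_pi_apply j)) measurable_const

end ConfigFacts

/-! ### Operations commuting with scaling and superposition -/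

section Naturality

variable {X : Type*} [MeasurableSpace X]

theorem measurable_scale_const (a : ℝ≥0) : Measurable (scale a : Config X → Config X) :=
  measurable_scale.comp (measurable_const.prodMk measurable_id)

/-- Independent operations on the points act separately on the parts of a superposition. -/
theorem piKernel_superpose (κ : Kernel (ℝ≥0 × X) (ℝ≥0 × X)) [IsMarkovKernel κ] (c d : Config X) :
    (piKernel fun _ : ℕ => κ) (superpose c d) =
      (((piKernel fun _ : ℕ => κ) c).prod ((piKernel fun _ : ℕ => κ) d)).map
        fun p => superpose p.1 p.2 := by
  symm
  refine Measure.eq_infinitePi _ fun s t ht => ?_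
  let e := Equiv.natSumNatEquivNat
  let s' : Finset (ℕ ⊕ ℕ) := s.map e.symm.toEmbedding
  have hpre : (fun p : Config X × Config X => superpose p.1 p.2) ⁻¹' ((s : Set ℕ).pi t) =
      ((s'.toLeft : Set ℕ).pi fun i => t (e (.inl i))) ×ˢ
        ((s'.toRight : Set ℕ).pi fun i => t (e (.inr i))) := by
    ext p
    simp only [Set.mem_preimage, Set.mem_pi, Set.mem_prod, Finset.mem_coe, Finset.mem_toLeft,
      Finset.mem_toRight, s', Finset.mem_map_equiv, Equiv.symm_symm]
    constructor
    · intro h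
      exact ⟨fun i hi => by simpa [superpose, e] using h _ hi,
        fun i hi => by simpa [superpose, e] using h _ hi⟩
    · rintro ⟨h1, h2⟩ k hk
      obtain ⟨i | i, rfl⟩ := e.surjective k
      · simpa [superpose, e] using h1 i hk
      · simpa [superpose, e] using h2 i hk
  rw [Measure.map_apply measurable_superpose (MeasurableSet.pi s.countable_toSet fun i _ => ht i),
    hpre, Measure.prod_prod, piKernel_apply, piKernel_apply,
    Measure.infinitePi_pi _ fun i _ => ht _, Measure.infinitePi_pi _ fun i _ => ht _]
  have hs : ∏ i ∈ s, κ (superpose c d i) (t i) =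
      ∏ i ∈ s', κ (superpose c d (e i)) (t (e i)) := by
    simp [s', Finset.prod_map]
  rw [hs, Finset.prod_sum_eq_prod_toLeft_mul_prod_toRight]
  simp [superpose, e]

theorem piKernel_scale (κ : Kernel (ℝ≥0 × X) (ℝ≥0 × X)) [IsMarkovKernel κ] (a : ℝ≥0)
    (hκ : ∀ p, κ (a * p.1, p.2) = (κ p).map fun z => (a * z.1, z.2)) (c : Config X) :
    (piKernel fun _ : ℕ => κ) (scale a c) = ((piKernel fun _ : ℕ => κ) c).map (scale a) := by
  have h := Measure.infinitePi_map_pi (fun k => κ (c k))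
    (f := fun _ z => (a * z.1, z.2)) (fun _ => by fun_prop)
  rw [piKernel_apply, piKernel_apply]
  simp_rw [scale, hκ]
  rw [← h]
  rfl

theorem thinPoint_scale (q : X → I) (hq : Measurable q) (a : ℝ≥0) (p : ℝ≥0 × X) :
    thinPoint q hq (a * p.1, p.2) = (thinPoint q hq p).map fun z => (a * z.1, z.2) := by
  refine Measure.ext_of_lintegral _ fun f hf => ?_
  have hm : Measurable fun z : ℝ≥0 × X => (a * z.1, z.2) := by fun_prop
  rw [lintegral_map hf hm, lintegral_thinPoint _ _ _ hf,
    lintegral_thinPoint _ _ _ (f := fun z => f (a * z.1, z.2)) (hf.comp hm)]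
  simp

theorem movePoint_scale (T : Kernel X X) [IsMarkovKernel T] (a : ℝ≥0) (p : ℝ≥0 × X) :
    movePoint T (a * p.1, p.2) = (movePoint T p).map fun z => (a * z.1, z.2) := by
  refine Measure.ext_of_lintegral _ fun f hf => ?_
  have hm : Measurable fun z : ℝ≥0 × X => (a * z.1, z.2) := by fun_prop
  rw [lintegral_map hf hm, lintegral_movePoint _ _ hf,
    lintegral_movePoint _ _ (f := fun z => f (a * z.1, z.2)) (hf.comp hm)]

theorem ae_piKernel {α β : Type*} [MeasurableSpace α] [MeasurableSpace β] (κ : Kernel α β)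
    [IsMarkovKernel κ] (c : ℕ → α) {p : ℕ → β → Prop} (h : ∀ k, ∀ᵐ z ∂κ (c k), p k z) :
    ∀ᵐ w ∂(piKernel fun _ : ℕ => κ) c, ∀ k, p k (w k) :=
  ae_all_iff.2 fun k =>
    (measurePreserving_eval_infinitePi (fun k => κ (c k)) k).quasiMeasurePreserving.ae (h k)

theorem ae_thinPoint_weight_le (q : X → I) (hq : Measurable q) (p : ℝ≥0 × X) :
    ∀ᵐ z ∂thinPoint q hq p, z.1 ≤ p.1 := by
  have hs : MeasurableSet {z : ℝ≥0 × X | z.1 ≤ p.1} := measurableSet_le (by fun_prop) (by fun_prop)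
  rw [thinPoint_apply, ae_add_measure_iff]
  exact ⟨Measure.ae_smul_measure ((ae_dirac_iff hs).2 le_rfl) _,
    Measure.ae_smul_measure ((ae_dirac_iff hs).2 zero_le) _⟩

theorem ae_movePoint_pow_weight_eq (T : Kernel X X) [IsMarkovKernel T] (n : ℕ) (p : ℝ≥0 × X) :
    ∀ᵐ z ∂(movePoint T ^ n) p, z.1 = p.1 := by
  have hs : ∀ p : ℝ≥0 × X, MeasurableSet {z : ℝ≥0 × X | z.1 = p.1} := fun p =>
    measurableSet_eq_fun (by fun_prop) (by fun_prop)
  have h1 : ∀ p, ∀ᵐ z ∂movePoint T p, z.1 = p.1 := fun p => by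
    change movePoint T p {z | z.1 = p.1}ᶜ = 0
    rw [← lintegral_indicator_one (hs p).compl,
      lintegral_movePoint T p (measurable_one.indicator (hs p).compl)]
    simp
  induction n generalizing p with
  | zero =>
    change ∀ᵐ z ∂(Kernel.id : Kernel (ℝ≥0 × X) (ℝ≥0 × X)) p, z.1 = p.1
    rw [Kernel.id_apply, ae_dirac_iff (hs p)]
  | succ n ih =>
    rw [pow_succ]
    change ∀ᵐ z ∂((movePoint T ^ n) ∘ₖ movePoint T) p, z.1 = p.1
    refine Kernel.ae_comp_of_ae_ae (hs p) ?_
    filter_upwards [h1 p] with y hy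
    filter_upwards [ih y] with z hz
    rw [hz, hy]

theorem ae_subsample_totalMass_le (q : X → I) (hq : Measurable q) (c : Config X) :
    ∀ᵐ w ∂subsample q hq c, totalMass w ≤ totalMass c := by
  filter_upwards [ae_piKernel (thinPoint q hq) c fun k => ae_thinPoint_weight_le q hq (c k)]
    with w hw
  exact ENNReal.tsum_le_tsum fun k => ENNReal.coe_le_coe.2 (hw k)

theorem transition_pow (T : Kernel X X) [IsMarkovKernel T] (n : ℕ) :
    transition T ^ n = piKernel fun _ : ℕ => movePoint T ^ n :=
  piKernel_pow _ _

theorem ae_transition_pow_totalMass_eq (T : Kernel X X) [IsMarkovKernel T] (n : ℕ)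
    (c : Config X) : ∀ᵐ w ∂(transition T ^ n) c, totalMass w = totalMass c := by
  rw [transition_pow]
  filter_upwards [ae_piKernel (movePoint T ^ n) c fun k => ae_movePoint_pow_weight_eq T n (c k)]
    with w hw
  exact tsum_congr fun k => by rw [hw k]

theorem ae_transition_totalMass_eq (T : Kernel X X) [IsMarkovKernel T] (c : Config X) :
    ∀ᵐ w ∂transition T c, totalMass w = totalMass c := by
  simpa using ae_transition_pow_totalMass_eq T 1 c

theorem ae_transition_comp_subsample_totalMass_le (T : Kernel X X) [IsMarkovKernel T] (q : X → I)
    (hq : Measurable q) (c : Config X) :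
    ∀ᵐ w ∂(transition T ∘ₖ subsample q hq) c, totalMass w ≤ totalMass c := by
  refine Kernel.ae_comp_of_ae_ae (measurableSet_le measurable_totalMass measurable_const) ?_
  filter_upwards [ae_subsample_totalMass_le q hq c] with w hw
  filter_upwards [ae_transition_totalMass_eq T w] with v hv
  rwa [hv]

/-- Point transition commutes with normalisation. -/
theorem transitionNRM_toNRM (T : Kernel X X) [IsMarkovKernel T] (c : Config X) :
    transitionNRM T (toNRM c) = (transition T c).map toNRM := by
  have h : transitionNRM T (toNRM c) =
      (transition T c).map fun w => (scale (totalMass c).toNNReal⁻¹ w, (totalMass c).toNNReal) := by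
    rw [transitionNRM, Kernel.parallelComp_apply, Kernel.id_apply, Measure.prod_dirac]
    simp only [toNRM, renormalize, one_mul]
    rw [transition, piKernel_scale _ _ (movePoint_scale T _),
      Measure.map_map (by fun_prop) (measurable_scale_const _)]
    rfl
  rw [h]
  refine Measure.map_congr ?_
  filter_upwards [ae_transition_totalMass_eq T c] with w hw
  simp only [toNRM, renormalize, one_mul, hw]

theorem transitionNRM_pow_toNRM (T : Kernel X X) [IsMarkovKernel T] (n : ℕ) (c : Config X) :
    (transitionNRM T ^ n) (toNRM c) = ((transition T ^ n) c).map toNRM := by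
  induction n generalizing c with
  | zero =>
    change (Kernel.id : Kernel (NRM X) (NRM X)) (toNRM c) =
      ((Kernel.id : Kernel (Config X) (Config X)) c).map toNRM
    rw [Kernel.id_apply, Kernel.id_apply, Measure.map_dirac' measurable_toNRM]
  | succ n ih =>
    rw [pow_succ, pow_succ]
    change ((transitionNRM T ^ n) ∘ₖ transitionNRM T) (toNRM c) =
      (((transition T ^ n) ∘ₖ transition T) c).map toNRM
    rw [Kernel.comp_apply, Kernel.comp_apply, transitionNRM_toNRM,
      Measure.map_comp _ _ measurable_toNRM]
    refine Measure.ext_of_lintegral _ fun f hf => ?_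
    rw [Measure.lintegral_bind (Kernel.aemeasurable _) hf.aemeasurable,
      Measure.lintegral_bind (Kernel.aemeasurable _) hf.aemeasurable,
      lintegral_map hf.lintegral_kernel measurable_toNRM]
    simp_rw [ih, Kernel.map_apply _ measurable_toNRM]

/-- Subsampling commutes with normalisation, for configurations of finite mass. -/
theorem subsampleNRM_toNRM (q : X → I) (hq : Measurable q) {c : Config X}
    (hc : totalMass c < ∞) : subsampleNRM q hq (toNRM c) = (subsample q hq c).map toNRM := by
  rw [subsampleNRM, Kernel.map_apply _ measurable_renormalize, Kernel.parallelComp_apply,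
    Kernel.id_apply, Measure.prod_dirac, Measure.map_map measurable_renormalize (by fun_prop)]
  simp only [toNRM, renormalize, one_mul]
  rw [subsample, piKernel_scale _ _ (thinPoint_scale q hq _),
    Measure.map_map (measurable_renormalize.comp (by fun_prop)) (measurable_scale_const _)]
  refine Measure.map_congr ?_
  filter_upwards [ae_subsample_totalMass_le q hq c] with w hw
  exact renormalize_scale hc hw

/-- One step of subsampling and point transition commutes with normalisation, for configurations of
finite mass. -/
theorem stepNRM_toNRM (T : Kernel X X) [IsMarkovKernel T] (q : X → I) (hq : Measurable q)
    {c : Config X} (hc : totalMass c < ∞) :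
    (transitionNRM T ∘ₖ subsampleNRM q hq) (toNRM c) =
      ((transition T ∘ₖ subsample q hq) c).map toNRM := by
  rw [Kernel.comp_apply, Kernel.comp_apply, subsampleNRM_toNRM q hq hc,
    Measure.map_comp _ _ measurable_toNRM]
  refine Measure.ext_of_lintegral _ fun f hf => ?_
  rw [Measure.lintegral_bind (Kernel.aemeasurable _) hf.aemeasurable,
    Measure.lintegral_bind (Kernel.aemeasurable _) hf.aemeasurable,
    lintegral_map hf.lintegral_kernel measurable_toNRM]
  simp_rw [transitionNRM_toNRM, Kernel.map_apply _ measurable_toNRM]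

end Naturality

/-! ### Laws of recursions -/

section Recursion

variable {E Ω : Type*} [MeasurableSpace E] [MeasurableSpace Ω] {P : Measure Ω}
  {K : Kernel E E} {op : E → E → E} {inp Y : ℕ → Ω → E}

theorem IsRecursion.aemeasurable (h : IsRecursion P K op inp Y)
    (hinp : ∀ j, AEMeasurable (inp j) P) (m : ℕ) : AEMeasurable (Y m) P := by
  cases m with
  | zero => exact (hinp 0).congr h.zero.symm
  | succ m => exact (h.succ m).aemeasurable_snd

/-- The laws of the inputs together with the first terms are determined by the recursion. -/
theorem IsRecursion.map_initial_eq {Y' : ℕ → Ω → E} (h : IsRecursion P K op inp Y)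
    (h' : IsRecursion P K op inp Y') (m : ℕ) :
    P.map (fun ω => ((fun j => inp j ω, fun i => Y i ω) : (ℕ → E) × (Fin (m + 1) → E))) =
      P.map (fun ω => ((fun j => inp j ω, fun i => Y' i ω) : (ℕ → E) × (Fin (m + 1) → E))) := by
  induction m with
  | zero =>
    refine Measure.map_congr ?_
    filter_upwards [h.zero, h'.zero] with ω hω hω'
    refine Prod.ext rfl (funext fun i => ?_)
    obtain rfl : i = 0 := Fin.fin_one_eq_zero i
    exact hω.trans hω'.symm
  | succ m ih =>
    have hsnoc : Measurable fun p : ((ℕ → E) × (Fin (m + 1) → E)) × E =>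
        ((p.1.1, Fin.snoc p.1.2 p.2) : (ℕ → E) × (Fin (m + 2) → E)) := by
      refine Measurable.prodMk (by fun_prop) (measurable_pi_lambda _ fun i => ?_)
      refine Fin.lastCases ?_ (fun i => ?_) i
      · simpa using measurable_snd
      · simp only [Fin.snoc_castSucc]
        fun_prop
    have key : ∀ {W : ℕ → Ω → E}, IsRecursion P K op inp W →
        P.map (fun ω => ((fun j => inp j ω, fun i => W i ω) : (ℕ → E) × (Fin (m + 2) → E))) =
        (P.map (fun ω => (((fun j => inp j ω, fun i => W i ω) :
          (ℕ → E) × (Fin (m + 1) → E)), W (m + 1) ω))).map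
          (fun p => (p.1.1, Fin.snoc p.1.2 p.2)) := by
      intro W hW
      rw [AEMeasurable.map_map_of_aemeasurable hsnoc.aemeasurable (hW.succ m).aemeasurable]
      congr 1
      funext ω
      refine Prod.ext rfl (funext fun i => ?_)
      refine Fin.lastCases ?_ (fun i => ?_) i
      · simp
      · simp
    rw [key h, key h', (h.succ m).map_eq, (h'.succ m).map_eq, ih]

/-- Finite measures on `C × (ℕ → E)` agree if their images in all `C × (Fin (m + 1) → E)` do. -/
theorem ext_of_initial_segments {C : Type*} [MeasurableSpace C] {μ ν : Measure (C × (ℕ → E))}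
    [IsFiniteMeasure μ] [IsFiniteMeasure ν]
    (h : ∀ m : ℕ, μ.map (fun p => ((p.1, fun i => p.2 i) : C × (Fin (m + 1) → E))) =
      ν.map (fun p => ((p.1, fun i => p.2 i) : C × (Fin (m + 1) → E)))) : μ = ν := by
  refine Measure.ext_prod fun {s t} hs ht => ?_
  have hr : ∀ ρ : Measure (C × (ℕ → E)),
      ρ (s ×ˢ t) = (ρ.restrict (s ×ˢ Set.univ)).map Prod.snd t := fun ρ => by
    rw [Measure.map_apply measurable_snd ht, Measure.restrict_apply (measurable_snd ht)]
    congr 1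
    ext p
    simp [and_comm]
  rw [hr, hr]
  congr 1
  refine IsProjectiveLimit.unique
    (P := fun J => ((ν.restrict (s ×ˢ Set.univ)).map Prod.snd).map J.restrict) ?_ fun _ => rfl
  intro J
  change ((μ.restrict (s ×ˢ Set.univ)).map Prod.snd).map J.restrict =
    ((ν.restrict (s ×ˢ Set.univ)).map Prod.snd).map J.restrict
  ext B hB
  let m := J.sup id
  let ψ : (Fin (m + 1) → E) → (J → E) := fun y j =>
    y ⟨j.1, Nat.lt_succ_of_le (Finset.le_sup (f := id) j.2)⟩
  have hψ : Measurable ψ := by fun_prop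
  have hb : ∀ ρ : Measure (C × (ℕ → E)),
      ((ρ.restrict (s ×ˢ Set.univ)).map Prod.snd).map J.restrict B =
        ρ.map (fun p => ((p.1, fun i => p.2 i) : C × (Fin (m + 1) → E))) (s ×ˢ (ψ ⁻¹' B)) := by
    intro ρ
    have hJ : Measurable (J.restrict : (ℕ → E) → (J → E)) := by fun_prop
    rw [Measure.map_apply hJ hB, Measure.map_apply measurable_snd (hJ hB),
      Measure.restrict_apply (measurable_snd (hJ hB)),
      Measure.map_apply (by fun_prop) (hs.prod (hψ hB))]
    congr 1
    ext p
    simp only [Set.mem_inter_iff, Set.mem_preimage, Set.mem_prod, Set.mem_univ, and_true]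
    rw [and_comm]
    rfl
  rw [hb, hb, h m]

variable [IsProbabilityMeasure P]

/-- The joint law of the inputs and the terms is determined by the recursion. -/
theorem IsRecursion.map_eq {Y' : ℕ → Ω → E} (h : IsRecursion P K op inp Y)
    (h' : IsRecursion P K op inp Y') (hinp : ∀ j, AEMeasurable (inp j) P) :
    P.map (fun ω => ((fun j => inp j ω, fun m => Y m ω) : (ℕ → E) × (ℕ → E))) =
      P.map (fun ω => ((fun j => inp j ω, fun m => Y' m ω) : (ℕ → E) × (ℕ → E))) := by
  refine ext_of_initial_segments fun m => ?_
  have hm : ∀ {W : ℕ → Ω → E}, IsRecursion P K op inp W →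
      AEMeasurable (fun ω => ((fun j => inp j ω, fun m => W m ω) : (ℕ → E) × (ℕ → E))) P :=
    fun hW => (aemeasurable_pi_lambda _ hinp).prodMk
      (aemeasurable_pi_lambda _ (hW.aemeasurable hinp))
  rw [AEMeasurable.map_map_of_aemeasurable (by fun_prop) (hm h),
    AEMeasurable.map_map_of_aemeasurable (by fun_prop) (hm h')]
  exact h.map_initial_eq h' m

variable [IsMarkovKernel K]

/-- The conditional law of `op v (c (m + 1))` given inputs `c` and `y`, where `v` has law `K y`. -/
def stepKernel (K : Kernel E E) (op : E → E → E) (m : ℕ) : Kernel ((ℕ → E) × E) E :=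
  ((K.comap Prod.snd measurable_snd) ×ₖ
    (Kernel.deterministic (fun h : (ℕ → E) × E => h.1 (m + 1))
      (by fun_prop))).map fun p => op p.1 p.2

/-- The conditional law of the `m`-th term of the recursion given all inputs. -/
def termKernel (K : Kernel E E) (op : E → E → E) : ℕ → Kernel (ℕ → E) E
  | 0 => Kernel.deterministic (fun c => c 0) (measurable_pi_apply 0)
  | m + 1 => (termKernel K op m ⊗ₖ stepKernel K op m).snd

theorem isMarkovKernel_stepKernel (hop : Measurable fun p : E × E => op p.1 p.2) (m : ℕ) :
    IsMarkovKernel (stepKernel K op m) := by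
  unfold stepKernel
  exact Kernel.IsMarkovKernel.map _ hop

theorem isMarkovKernel_termKernel (hop : Measurable fun p : E × E => op p.1 p.2) (m : ℕ) :
    IsMarkovKernel (termKernel K op m) := by
  induction m with
  | zero => exact inferInstanceAs (IsMarkovKernel (Kernel.deterministic _ _))
  | succ m ih =>
    have := isMarkovKernel_stepKernel (K := K) hop m
    exact inferInstanceAs (IsMarkovKernel (termKernel K op m ⊗ₖ stepKernel K op m).snd)

theorem stepKernel_apply (hop : Measurable fun p : E × E => op p.1 p.2) (m : ℕ)
    (c : ℕ → E) (y : E) :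
    stepKernel K op m (c, y) = (K y).map fun v => op v (c (m + 1)) := by
  rw [stepKernel, Kernel.map_apply _ hop, Kernel.prod_apply, Kernel.deterministic_apply,
    Measure.prod_dirac, Measure.map_map hop (by fun_prop)]
  rfl

theorem termKernel_succ_apply (hop : Measurable fun p : E × E => op p.1 p.2) (m : ℕ)
    (c : ℕ → E) :
    termKernel K op (m + 1) c =
      (K ∘ₘ termKernel K op m c).map fun v => op v (c (m + 1)) := by
  have := isMarkovKernel_stepKernel (K := K) hop m
  have := isMarkovKernel_termKernel (K := K) hop m
  have hop' : Measurable fun v => op v (c (m + 1)) := hop.comp measurable_prodMk_right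
  refine Measure.ext_of_lintegral _ fun f hf => ?_
  rw [lintegral_map hf hop', Measure.lintegral_bind (f := fun v => f (op v (c (m + 1))))
    (Kernel.aemeasurable _) (hf.comp hop').aemeasurable, termKernel, Kernel.lintegral_snd _ _ hf,
    Kernel.lintegral_compProd _ _ _ (f := fun p => f p.2) (hf.comp measurable_snd)]
  refine lintegral_congr fun y => ?_
  rw [stepKernel_apply hop, lintegral_map hf hop']

theorem stepKernel_comap (hop : Measurable fun p : E × E => op p.1 p.2) (m : ℕ) :
    (stepKernel K op m).comap
        (fun h : (ℕ → E) × (Fin (m + 1) → E) => (h.1, h.2 (Fin.last m))) (by fun_prop) =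
      ((K.comap (fun h : (ℕ → E) × (Fin (m + 1) → E) => h.2 (Fin.last m)) (by fun_prop)) ×ₖ
        (Kernel.deterministic (fun h : (ℕ → E) × (Fin (m + 1) → E) => h.1 (m + 1))
          (by fun_prop))).map (fun p => op p.1 p.2) := by
  refine Kernel.ext fun g => ?_
  rw [Kernel.comap_apply, stepKernel, Kernel.map_apply _ hop, Kernel.map_apply _ hop,
    Kernel.prod_apply, Kernel.prod_apply]
  rfl

theorem IsRecursion.hasCondDistrib_input (h : IsRecursion P K op inp Y)
    (hop : Measurable fun p : E × E => op p.1 p.2) (hinp : ∀ j, AEMeasurable (inp j) P) (m : ℕ) :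
    HasCondDistrib (Y m) (fun ω j => inp j ω) (termKernel K op m) P := by
  have hinp' : AEMeasurable (fun ω j => inp j ω) P := aemeasurable_pi_lambda _ hinp
  induction m with
  | zero =>
    refine ⟨hinp'.prodMk (h.aemeasurable hinp 0), ?_⟩
    rw [termKernel, Measure.compProd_deterministic,
      AEMeasurable.map_map_of_aemeasurable (by fun_prop) hinp']
    refine Measure.map_congr ?_
    filter_upwards [h.zero] with ω hω
    exact Prod.ext rfl hω
  | succ m ih =>
    have := isMarkovKernel_stepKernel (K := K) hop m
    have := isMarkovKernel_termKernel (K := K) hop m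
    have hf : Measurable fun g : (ℕ → E) × (Fin (m + 1) → E) => (g.1, g.2 (Fin.last m)) := by
      fun_prop
    have hstep : HasCondDistrib (Y (m + 1)) (fun ω => ((fun j => inp j ω), Y m ω))
        (stepKernel K op m) P := by
      refine HasCondDistrib.comp_right (hf := hf)
        (Z := fun ω => ((fun j => inp j ω, fun i => Y i ω) : (ℕ → E) × (Fin (m + 1) → E))) ?_
      rw [stepKernel_comap hop]
      exact h.succ m
    have hpair : HasCondDistrib (fun ω => (Y m ω, Y (m + 1) ω)) (fun ω j => inp j ω)
        (termKernel K op m ⊗ₖ stepKernel K op m) P := by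
      have hY := h.aemeasurable hinp m
      have hY' := h.aemeasurable hinp (m + 1)
      refine ⟨hinp'.prodMk (hY.prodMk hY'), ?_⟩
      rw [← Measure.compProd_assoc', ← ih.map_eq, ← hstep.map_eq,
        AEMeasurable.map_map_of_aemeasurable (by fun_prop) hstep.aemeasurable]
      rfl
    exact hpair.snd

end Recursion

/-! ### Laws of the terms of the unnormalised recursion -/

section Terms

variable {X : Type*} [MeasurableSpace X]

/-- The law of the iterated superposition of independent configurations with laws `μ 0, …, μ m`. -/
def superposeLaw : ℕ → (ℕ → Measure (Config X)) → Measure (Config X)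
  | 0, μ => μ 0
  | m + 1, μ => ((superposeLaw m μ).prod (μ (m + 1))).map fun p => superpose p.1 p.2

theorem superposeLaw_congr {m : ℕ} {μ μ' : ℕ → Measure (Config X)} (h : ∀ j ≤ m, μ j = μ' j) :
    superposeLaw m μ = superposeLaw m μ' := by
  induction m with
  | zero => exact h 0 le_rfl
  | succ m ih =>
    rw [superposeLaw, superposeLaw, ih fun j hj => h j (hj.trans m.le_succ), h (m + 1) le_rfl]

theorem isProbabilityMeasure_superposeLaw (m : ℕ) (μ : ℕ → Measure (Config X))
    [∀ j, IsProbabilityMeasure (μ j)] : IsProbabilityMeasure (superposeLaw m μ) := by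
  induction m with
  | zero => exact inferInstanceAs (IsProbabilityMeasure (μ 0))
  | succ m ih =>
    rw [superposeLaw]
    exact Measure.isProbabilityMeasure_map measurable_superpose.aemeasurable

/-- A kernel acting separately on the parts of a superposition acts separately on the parts of an
iterated superposition. -/
theorem comp_superposeLaw {K : Kernel (Config X) (Config X)} [IsMarkovKernel K]
    (hK : ∀ c d, K (superpose c d) = ((K c).prod (K d)).map fun p => superpose p.1 p.2)
    (m : ℕ) (μ : ℕ → Measure (Config X)) [∀ j, IsProbabilityMeasure (μ j)] :
    K ∘ₘ superposeLaw m μ = superposeLaw m fun j => K ∘ₘ μ j := by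
  induction m with
  | zero => rfl
  | succ m ih =>
    have := isProbabilityMeasure_superposeLaw m μ
    rw [superposeLaw, superposeLaw, ← ih, Measure.prod_comp_right, Measure.prod_comp_left,
      Measure.comp_assoc, Measure.map_comp _ _ measurable_superpose]
    refine Measure.ext_of_lintegral _ fun f hf => ?_
    rw [Measure.lintegral_bind (Kernel.aemeasurable _) hf.aemeasurable,
      Measure.lintegral_bind (Kernel.aemeasurable _) hf.aemeasurable,
      lintegral_map hf.lintegral_kernel measurable_superpose]
    refine lintegral_congr fun p => ?_
    rw [Kernel.map_apply _ measurable_superpose, Kernel.parallelComp_comp_parallelComp,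
      Kernel.id_comp, Kernel.comp_id, Kernel.parallelComp_apply, hK]

/-- Given inputs `c`, the `m`-th term is the iterated superposition of independent configurations,
the `j`-th of which results from `m - j` applications of `K` to `c j`. -/
theorem termKernel_superpose {K : Kernel (Config X) (Config X)} [IsMarkovKernel K]
    (hK : ∀ c d, K (superpose c d) = ((K c).prod (K d)).map fun p => superpose p.1 p.2)
    (m : ℕ) (c : ℕ → Config X) :
    termKernel K superpose m c = superposeLaw m fun j => (K ^ (m - j)) (c j) := by
  induction m with
  | zero =>
    rw [termKernel, Kernel.deterministic_apply]
    exact (Kernel.id_apply (c 0)).symm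
  | succ m ih =>
    have := isProbabilityMeasure_superposeLaw m fun j => (K ^ (m - j)) (c j)
    have := isProbabilityMeasure_superposeLaw m fun j => (K ^ (m + 1 - j)) (c j)
    have hlast : (K ^ (m + 1 - (m + 1))) (c (m + 1)) = Measure.dirac (c (m + 1)) := by
      rw [Nat.sub_self]
      exact Kernel.id_apply _
    rw [termKernel_succ_apply measurable_superpose, ih, superposeLaw, hlast, Measure.prod_dirac,
      Measure.map_map measurable_superpose (by fun_prop), comp_superposeLaw hK]
    rw [superposeLaw_congr (μ' := fun j => (K ^ (m + 1 - j)) (c j)) fun j hj => ?_]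
    · rfl
    · rw [Nat.sub_add_comm hj, pow_succ']
      exact (Kernel.comp_apply K (K ^ (m - j)) (c j)).symm

theorem measurable_sum_toMeasure (n : ℕ) :
    Measurable fun w : Fin n → Config X => ∑ j, toMeasure (w j) :=
  Finset.measurable_sum _ fun j _ => measurable_toMeasure.comp (measurable_pi_apply j)

theorem map_toMeasure_superposeLaw (m : ℕ) (μ : ℕ → Measure (Config X))
    [∀ j, IsProbabilityMeasure (μ j)] :
    (superposeLaw m μ).map toMeasure =
      (Measure.infinitePi fun j : Fin (m + 1) => μ j).map fun w => ∑ j, toMeasure (w j) := by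
  induction m with
  | zero =>
    have h := Measure.infinitePi_map_eval (fun j : Fin 1 => μ j) 0
    have hf : (fun w : Fin (0 + 1) → Config X => ∑ j, toMeasure (w j)) =
        toMeasure ∘ fun w => w 0 := by
      funext w
      simp
    rw [hf, ← Measure.map_map measurable_toMeasure (measurable_pi_apply 0)]
    exact congrArg _ h.symm
  | succ m ih =>
    have := isProbabilityMeasure_superposeLaw m μ
    have hadd : Measurable fun p : Measure X × Measure X => p.1 + p.2 := measurable_add
    have hL : (superposeLaw (m + 1) μ).map toMeasure =
        (((superposeLaw m μ).map toMeasure).prod ((μ (m + 1)).map toMeasure)).map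
          fun p => p.1 + p.2 := by
      rw [superposeLaw, Measure.map_map measurable_toMeasure measurable_superpose,
        Measure.map_prod_map _ _ measurable_toMeasure measurable_toMeasure,
        Measure.map_map hadd (measurable_toMeasure.prodMap measurable_toMeasure)]
      congr 1
      funext p
      exact toMeasure_superpose p.1 p.2
    have hpi := (measurePreserving_piFinSuccAbove (fun j : Fin (m + 2) => μ j) (Fin.last _)).map_eq
    rw [hL, ih, Measure.infinitePi_eq_pi, Measure.infinitePi_eq_pi,
      Measure.map_prod_map _ _ (measurable_sum_toMeasure _) measurable_toMeasure,
      Measure.map_map hadd ((measurable_sum_toMeasure _).prodMap measurable_toMeasure),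
      ← Measure.prod_swap, Measure.map_map (hadd.comp ((measurable_sum_toMeasure _).prodMap
      measurable_toMeasure)) measurable_swap]
    have hlast : (μ ((Fin.last (m + 1) : Fin (m + 2)) : ℕ)).prod
        (Measure.pi fun j : Fin (m + 1) => μ ((Fin.last (m + 1)).succAbove j)) =
        (μ (m + 1)).prod (Measure.pi fun j : Fin (m + 1) => μ j) := by
      simp [Fin.succAbove_last]
    rw [← hlast, ← hpi, Measure.map_map ((hadd.comp ((measurable_sum_toMeasure _).prodMap
      measurable_toMeasure)).comp measurable_swap) (MeasurableEquiv.measurable _)]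
    congr 1
    funext w
    simp [Fin.sum_univ_castSucc, MeasurableEquiv.piFinSuccAbove, Fin.insertNthEquiv, Fin.init]

end Terms

/-! ### The mixture -/

section Mixture

variable {X : Type*} [MeasurableSpace X]

theorem measurable_normalize : Measurable (normalize : Measure X → Measure X) := by
  refine Measure.measurable_of_measurable_coe _ fun s hs => ?_
  simp only [normalize, Measure.smul_apply, smul_eq_mul]
  exact (Measure.measurable_coe MeasurableSet.univ).inv.mul (Measure.measurable_coe hs)

theorem normalize_sum_toMeasure {n : ℕ} {w : Fin n → Config X} (hw : ∀ j, totalMass (w j) < ∞) :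
    normalize (∑ j, toMeasure (w j)) =
      ∑ j, (totalMass (w j) / ∑ i, totalMass (w i)) • toMeasure (toNRM (w j)).1 := by
  have huniv : (∑ j, toMeasure (w j)) Set.univ = ∑ j, totalMass (w j) := by
    simp [Measure.finsetSum_apply, toMeasure_univ]
  rw [normalize, huniv, Finset.smul_sum]
  refine Finset.sum_congr rfl fun j _ => ?_
  rw [toMeasure_toNRM, normalize, toMeasure_univ, smul_smul]
  by_cases h0 : totalMass (w j) = 0
  · have : toMeasure (w j) = 0 := by
      rw [← Measure.measure_univ_eq_zero, toMeasure_univ, h0]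
    simp [this]
  · rw [div_eq_mul_inv, mul_right_comm, ENNReal.mul_inv_cancel h0 (hw j).ne, one_mul]

/-- For configurations of finite mass, the weights of the mixture cancel the individual
normalisations, and what remains is the normalised sum of the moved configurations. -/
theorem mixture_apply (T : Kernel X X) [IsMarkovKernel T] (m : ℕ) {η : Fin (m + 1) → Config X}
    (hη : ∀ j, totalMass (η j) < ∞) :
    mixture T m η =
      ((piKernel fun j : Fin (m + 1) => transition T ^ (m - (j : ℕ))) η).map
        fun w => normalize (∑ j, toMeasure (w j)) := by
  have hpi : (piKernel fun j : Fin (m + 1) => transitionNRM T ^ (m - (j : ℕ)))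
      (fun j => toNRM (η j)) =
      ((piKernel fun j : Fin (m + 1) => transition T ^ (m - (j : ℕ))) η).map
        fun w j => toNRM (w j) := by
    rw [piKernel_apply, piKernel_apply, Measure.infinitePi_map_pi _ fun _ => measurable_toNRM]
    simp_rw [transitionNRM_pow_toNRM]
  have htoNRM : Measurable fun (w : Fin (m + 1) → Config X) j => toNRM (w j) :=
    measurable_pi_lambda _ fun j => measurable_toNRM.comp (measurable_pi_apply j)
  have hmix := measurable_mixture_sum (X := X) m
  rw [mixture, Kernel.map_apply _ hmix, Kernel.prod_apply, Kernel.id_apply, Kernel.comap_apply,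
    hpi, Measure.dirac_prod, Measure.map_map hmix (by fun_prop),
    Measure.map_map (hmix.comp (by fun_prop)) htoNRM]
  refine Measure.map_congr ?_
  have hmass : ∀ᵐ w ∂(piKernel fun j : Fin (m + 1) => transition T ^ (m - (j : ℕ))) η,
      ∀ j, totalMass (w j) = totalMass (η j) := ae_all_iff.2 fun j =>
    (measurePreserving_eval_infinitePi (fun j : Fin (m + 1) =>
      (transition T ^ (m - (j : ℕ))) (η j)) j).quasiMeasurePreserving.ae
      (ae_transition_pow_totalMass_eq T _ (η j))
  filter_upwards [hmass] with w hw
  rw [normalize_sum_toMeasure fun j => (hw j).symm ▸ hη j]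
  simp only [Function.comp_apply, hw]

/-- The mixture of independent configurations of finite mass is the normalised sum of independently
moved configurations. -/
theorem mixture_comp_infinitePi (T : Kernel X X) [IsMarkovKernel T] (m : ℕ)
    (μ : Fin (m + 1) → Measure (Config X)) [∀ j, IsProbabilityMeasure (μ j)]
    (hμ : ∀ j, ∀ᵐ c ∂μ j, totalMass c < ∞) :
    mixture T m ∘ₘ Measure.infinitePi μ =
      (Measure.infinitePi fun j => (transition T ^ (m - (j : ℕ))) ∘ₘ μ j).map
        fun w => normalize (∑ j, toMeasure (w j)) := by
  have hG : Measurable fun w : Fin (m + 1) → Config X => normalize (∑ j, toMeasure (w j)) :=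
    measurable_normalize.comp (measurable_sum_toMeasure _)
  have hfin : ∀ᵐ η ∂Measure.infinitePi μ, ∀ j, totalMass (η j) < ∞ := ae_all_iff.2 fun j =>
    (measurePreserving_eval_infinitePi μ j).quasiMeasurePreserving.ae (hμ j)
  rw [← piKernel_comp_infinitePi, Measure.map_comp _ _ hG]
  refine Measure.comp_congr ?_
  filter_upwards [hfin] with η hη
  rw [mixture_apply T m hη, Kernel.map_apply _ hG]

/-- The law of the mixture depends only on the laws of the moved random measures. -/
theorem mixture_comp_infinitePi_eq_map (T : Kernel X X) [IsMarkovKernel T] (m : ℕ)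
    (μ : Fin (m + 1) → Measure (Config X)) [∀ j, IsProbabilityMeasure (μ j)]
    (hμ : ∀ j, ∀ᵐ c ∂μ j, totalMass c < ∞) :
    mixture T m ∘ₘ Measure.infinitePi μ =
      (Measure.infinitePi fun j => ((transition T ^ (m - (j : ℕ))) ∘ₘ μ j).map toMeasure).map
        fun M => normalize (∑ j, M j) := by
  have hsum : Measurable fun M : Fin (m + 1) → Measure X => normalize (∑ j, M j) :=
    measurable_normalize.comp (Finset.measurable_sum _ fun j _ => measurable_pi_apply j)
  rw [mixture_comp_infinitePi T m μ hμ,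
    ← Measure.infinitePi_map_pi _ fun _ => measurable_toMeasure, Measure.map_map hsum]
  · rfl
  · exact measurable_pi_lambda _ fun j => measurable_toMeasure.comp (measurable_pi_apply j)

/-- Given inputs of finite mass, the normalised term of the unnormalised recursion has the law of
the mixture built from the subsampled inputs. -/
theorem termKernel_map_normalize (T : Kernel X X) [IsMarkovKernel T] (q : X → I)
    (hq : Measurable q) (hinv : ∀ x, ∀ᵐ y ∂T x, q y = q x) (m : ℕ) {c : ℕ → Config X}
    (hc : ∀ j, totalMass (c j) < ∞) :
    (termKernel (transition T ∘ₖ subsample q hq) superpose m c).map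
        (fun y => normalize (toMeasure y)) = (mixture T m ∘ₖ subsampleInputs q hq m) c := by
  have hK : ∀ c d, (transition T ∘ₖ subsample q hq) (superpose c d) =
      (((transition T ∘ₖ subsample q hq) c).prod ((transition T ∘ₖ subsample q hq) d)).map
        fun p => superpose p.1 p.2 := by
    rw [transition_comp_subsample]
    exact piKernel_superpose _
  have hL : (termKernel (transition T ∘ₖ subsample q hq) superpose m c).map
      (fun y => normalize (toMeasure y)) =
      (Measure.infinitePi fun j : Fin (m + 1) =>
        ((transition T ∘ₖ subsample q hq) ^ (m - (j : ℕ))) (c j)).map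
          fun w => normalize (∑ j, toMeasure (w j)) := by
    have h := map_toMeasure_superposeLaw m
      fun j => ((transition T ∘ₖ subsample q hq) ^ (m - j)) (c j)
    rw [termKernel_superpose hK]
    change Measure.map (normalize ∘ toMeasure) _ =
      Measure.map (normalize ∘ fun w : Fin (m + 1) → Config X => ∑ j, toMeasure (w j)) _
    rw [← Measure.map_map measurable_normalize measurable_toMeasure,
      ← Measure.map_map measurable_normalize (measurable_sum_toMeasure _), h]
  have hR : subsampleInputs q hq m c = Measure.infinitePi fun j : Fin (m + 1) =>
      subsample (fun x => q x ^ (m - (j : ℕ))) (measurable_pow hq _) (c j) := rfl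
  rw [hL, Kernel.comp_apply, hR, mixture_comp_infinitePi T m _ fun j => ?_]
  · congr 2
    funext j
    rw [transition_comp_subsample_pow T q hq hinv]
    exact Kernel.comp_apply _ _ _
  · filter_upwards [ae_subsample_totalMass_le _ (measurable_pow hq (m - (j : ℕ))) (c j)] with w hw
    exact hw.trans_lt (hc j)

end Mixture

/-! ### The two recursions -/

section TwoRecursions

variable {X : Type*} [MeasurableSpace X] {Ω : Type*} [MeasurableSpace Ω] {P : Measure Ω}
  [IsProbabilityMeasure P] {T : Kernel X X} [IsMarkovKernel T] {q : X → I} {hq : Measurable q}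
  {π Y : ℕ → Ω → Config X}

theorem ae_termKernel_totalMass_lt_top (T : Kernel X X) [IsMarkovKernel T] (q : X → I)
    (hq : Measurable q) (m : ℕ) {c : ℕ → Config X} (hc : ∀ j, totalMass (c j) < ∞) :
    ∀ᵐ y ∂termKernel (transition T ∘ₖ subsample q hq) superpose m c, totalMass y < ∞ := by
  have hs := measurableSet_totalMass_lt_top (X := X)
  induction m with
  | zero =>
    rw [termKernel, Kernel.deterministic_apply, ae_dirac_iff hs]
    exact hc 0
  | succ m ih =>
    have hsup : Measurable fun v : Config X => superpose v (c (m + 1)) :=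
      measurable_superpose.comp measurable_prodMk_right
    rw [termKernel_succ_apply measurable_superpose, ae_map_iff hsup.aemeasurable hs]
    refine Measure.ae_comp_of_ae_ae (hsup hs) ?_
    filter_upwards [ih] with y hy
    filter_upwards [ae_transition_comp_subsample_totalMass_le T q hq y] with v hv
    rw [totalMass_superpose]
    exact ENNReal.add_lt_top.2 ⟨hv.trans_lt hy, hc _⟩

theorem IsRecursion.ae_totalMass_lt_top
    (hY : IsRecursion P (transition T ∘ₖ subsample q hq) superpose π Y)
    (hπ : ∀ j, Measurable (π j)) (hfin : ∀ᵐ ω ∂P, ∀ j, totalMass (π j ω) < ∞) (m : ℕ) :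
    ∀ᵐ ω ∂P, totalMass (Y m ω) < ∞ := by
  have := isMarkovKernel_termKernel (K := transition T ∘ₖ subsample q hq) measurable_superpose m
  have hπ' : Measurable fun ω j => π j ω := measurable_pi_lambda _ hπ
  have hp : MeasurableSet {p : (ℕ → Config X) × Config X | totalMass p.2 < ∞} :=
    measurableSet_lt (measurable_totalMass.comp measurable_snd) measurable_const
  have hlaw := hY.hasCondDistrib_input measurable_superpose (fun j => (hπ j).aemeasurable) m
  refine (HasLaw.ae_iff hlaw (p := fun p => totalMass p.2 < ∞) (measurableSet_setOfPred.1 hp)).2 ?_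
  refine Measure.ae_compProd_of_ae_ae hp ?_
  filter_upwards [(ae_map_iff hπ'.aemeasurable
    measurableSet_forall_totalMass_lt_top).2 hfin] with c hc
  exact ae_termKernel_totalMass_lt_top T q hq m hc

/-- The normalisation of the unnormalised recursion follows the recursion of normalised random
measures. -/
theorem IsRecursion.toNRM (hY : IsRecursion P (transition T ∘ₖ subsample q hq) superpose π Y)
    (hπ : ∀ j, Measurable (π j)) (hfin : ∀ᵐ ω ∂P, ∀ j, totalMass (π j ω) < ∞) :
    IsRecursion P (transitionNRM T ∘ₖ subsampleNRM q hq) superposeNRM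
      (fun j ω => toNRM (π j ω)) (fun m ω => toNRM (Y m ω)) := by
  refine ⟨?_, fun m => ?_⟩
  · filter_upwards [hY.zero] with ω hω
    exact congrArg _ hω
  let K := transition T ∘ₖ subsample q hq
  let K' := transitionNRM T ∘ₖ subsampleNRM q hq
  have := isMarkovKernel_stepKernel (K := K) measurable_superpose m
  have := isMarkovKernel_stepKernel (K := K') measurable_superposeNRM m
  let F : (ℕ → Config X) × (Fin (m + 1) → Config X) → (ℕ → NRM X) × (Fin (m + 1) → NRM X) :=
    fun h => (fun j => DependentNRM.toNRM (h.1 j), fun i => DependentNRM.toNRM (h.2 i))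
  have hF : Measurable F := Measurable.prodMk
    (measurable_pi_lambda _ fun j => measurable_toNRM.comp (by fun_prop))
    (measurable_pi_lambda _ fun j => measurable_toNRM.comp (by fun_prop))
  have hlast : ∀ {E : Type _} [MeasurableSpace E],
      Measurable fun h : (ℕ → E) × (Fin (m + 1) → E) => (h.1, h.2 (Fin.last m)) := by
    intros
    fun_prop
  have hYm := fun m => hY.aemeasurable (fun j => (hπ j).aemeasurable) m
  have hhist : AEMeasurable (fun ω => ((fun j => π j ω, fun i => Y i ω) :
      (ℕ → Config X) × (Fin (m + 1) → Config X))) P :=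
    (aemeasurable_pi_lambda _ fun j => (hπ j).aemeasurable).prodMk
      (aemeasurable_pi_lambda _ fun i => hYm i)
  have hs := hY.succ m
  have hs' : HasCondDistrib (Y (m + 1))
      (fun ω => ((fun j => π j ω, fun i => Y i ω) : (ℕ → Config X) × (Fin (m + 1) → Config X)))
      ((stepKernel K superpose m).comap _ hlast) P := by
    rw [stepKernel_comap measurable_superpose]
    exact hs
  have hgoal : HasCondDistrib (fun ω => DependentNRM.toNRM (Y (m + 1) ω))
      (F ∘ fun ω => ((fun j => π j ω, fun i => Y i ω) :
        (ℕ → Config X) × (Fin (m + 1) → Config X)))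
      ((stepKernel K' superposeNRM m).comap _ hlast) P := by
    refine HasCondDistrib.comp_right (hf := hF) ⟨?_, ?_⟩
    · exact hhist.prodMk (measurable_toNRM.comp_aemeasurable (hYm _))
    · refine (hs'.comp_left measurable_toNRM).map_eq.trans (Measure.compProd_congr ?_)
      have hset : MeasurableSet {h : (ℕ → Config X) × (Fin (m + 1) → Config X) |
          totalMass (h.2 (Fin.last m)) < ∞ ∧ totalMass (h.1 (m + 1)) < ∞} :=
        (measurableSet_lt (measurable_totalMass.comp (by fun_prop)) measurable_const).inter
          (measurableSet_lt (measurable_totalMass.comp (by fun_prop)) measurable_const)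
      have hae : ∀ᵐ h ∂P.map (fun ω => ((fun j => π j ω, fun i => Y i ω) :
          (ℕ → Config X) × (Fin (m + 1) → Config X))),
          totalMass (h.2 (Fin.last m)) < ∞ ∧ totalMass (h.1 (m + 1)) < ∞ := by
        refine (ae_map_iff hhist hset).2 ?_
        filter_upwards [hfin, hY.ae_totalMass_lt_top hπ hfin m] with ω h1 h2
        exact ⟨h2, h1 _⟩
      filter_upwards [hae] with h hh
      have hop : Measurable fun v => superpose v (h.1 (m + 1)) :=
        measurable_superpose.comp measurable_prodMk_right
      have hop' : Measurable fun v => superposeNRM v (DependentNRM.toNRM (h.1 (m + 1))) :=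
        measurable_superposeNRM.comp measurable_prodMk_right
      rw [Kernel.map_apply _ measurable_toNRM, Kernel.comap_apply, Kernel.comap_apply,
        Kernel.comap_apply, stepKernel_apply measurable_superpose,
        stepKernel_apply measurable_superposeNRM, stepNRM_toNRM T q hq hh.1,
        Measure.map_map measurable_toNRM hop, Measure.map_map hop' measurable_toNRM]
      refine Measure.map_congr ?_
      filter_upwards [ae_transition_comp_subsample_totalMass_le T q hq (h.2 (Fin.last m))]
        with v hv
      exact (superposeNRM_toNRM (hv.trans_lt hh.1) hh.2).symm
  rw [stepKernel_comap measurable_superposeNRM] at hgoal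
  exact hgoal

/-- The law of a normalised recursion, jointly with the inputs, agrees with that of the
normalisation of the unnormalised recursion; the inputs are recovered from their normalisations and
total masses. -/
theorem identDistrib_recursions
    (hY : IsRecursion P (transition T ∘ₖ subsample q hq) superpose π Y)
    {Z : ℕ → Ω → NRM X}
    (hZ : IsRecursion P (transitionNRM T ∘ₖ subsampleNRM q hq) superposeNRM
      (fun j ω => toNRM (π j ω)) Z)
    (hπ : ∀ j, Measurable (π j)) (hfin : ∀ᵐ ω ∂P, ∀ j, totalMass (π j ω) < ∞) :
    IdentDistrib
      (fun ω => ((fun j => π j ω, fun m => toMeasure (Z m ω).1) :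
        (ℕ → Config X) × (ℕ → Measure X)))
      (fun ω => ((fun j => π j ω, fun m => normalize (toMeasure (Y m ω))) :
        (ℕ → Config X) × (ℕ → Measure X))) P P := by
  have hinp : ∀ j, AEMeasurable (fun ω => toNRM (π j ω)) P := fun j =>
    (measurable_toNRM.comp (hπ j)).aemeasurable
  have hY' := hY.toNRM hπ hfin
  have hπ' : AEMeasurable (fun ω j => π j ω) P := (measurable_pi_lambda _ hπ).aemeasurable
  -- `Ψ` recovers the inputs from their normalisations.
  let Ψ : (ℕ → NRM X) × (ℕ → NRM X) → (ℕ → Config X) × (ℕ → Measure X) := fun p =>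
    (fun j => scale (p.1 j).2 (p.1 j).1, fun m => toMeasure (p.2 m).1)
  have hΨ : Measurable Ψ := Measurable.prodMk
    (measurable_pi_lambda _ fun j => measurable_scale.comp
      (Measurable.prodMk (by fun_prop) (by fun_prop)))
    (measurable_pi_lambda _ fun m => measurable_toMeasure.comp (by fun_prop))
  have hm : ∀ {W : ℕ → Ω → NRM X}, IsRecursion P (transitionNRM T ∘ₖ subsampleNRM q hq)
      superposeNRM (fun j ω => toNRM (π j ω)) W →
      AEMeasurable (fun ω => ((fun j => toNRM (π j ω), fun m => W m ω) :
        (ℕ → NRM X) × (ℕ → NRM X))) P := fun hW =>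
    (aemeasurable_pi_lambda _ hinp).prodMk (aemeasurable_pi_lambda _ (hW.aemeasurable hinp))
  have hmap : ∀ {W : ℕ → Ω → NRM X}, IsRecursion P (transitionNRM T ∘ₖ subsampleNRM q hq)
      superposeNRM (fun j ω => toNRM (π j ω)) W →
      P.map (fun ω => ((fun j => π j ω, fun m => toMeasure (W m ω).1) :
        (ℕ → Config X) × (ℕ → Measure X))) =
      (P.map (fun ω => ((fun j => toNRM (π j ω), fun m => W m ω) :
        (ℕ → NRM X) × (ℕ → NRM X)))).map Ψ := by
    intro W hW
    rw [AEMeasurable.map_map_of_aemeasurable hΨ.aemeasurable (hm hW)]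
    refine Measure.map_congr ?_
    filter_upwards [hfin] with ω hω
    exact Prod.ext (funext fun j => (scale_toNRM (hω j)).symm) rfl
  refine ⟨?_, ?_, ?_⟩
  · exact hπ'.prodMk (aemeasurable_pi_lambda _ fun m => measurable_toMeasure.comp_aemeasurable
      (measurable_fst.comp_aemeasurable (hZ.aemeasurable hinp m)))
  · exact hπ'.prodMk (aemeasurable_pi_lambda _ fun m => measurable_normalize.comp_aemeasurable
      (measurable_toMeasure.comp_aemeasurable
        (hY.aemeasurable (fun j => (hπ j).aemeasurable) m)))
  · simp_rw [← toMeasure_toNRM]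
    rw [hmap hZ, hmap hY', hZ.map_eq hY' hinp]

/-- Given the inputs, the normalised terms of the unnormalised recursion have the law of the
mixture built from the subsampled inputs. -/
theorem IsRecursion.hasCondDistrib_mixture
    (hY : IsRecursion P (transition T ∘ₖ subsample q hq) superpose π Y)
    (hinv : ∀ x, ∀ᵐ y ∂T x, q y = q x) (hπ : ∀ j, Measurable (π j))
    (hfin : ∀ᵐ ω ∂P, ∀ j, totalMass (π j ω) < ∞) (m : ℕ) :
    HasCondDistrib (fun ω => normalize (toMeasure (Y m ω))) (fun ω j => π j ω)
      (mixture T m ∘ₖ subsampleInputs q hq m) P := by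
  have := isMarkovKernel_termKernel (K := transition T ∘ₖ subsample q hq) measurable_superpose m
  have hπ' : Measurable fun ω j => π j ω := measurable_pi_lambda _ hπ
  have hG : Measurable fun y : Config X => normalize (toMeasure y) :=
    measurable_normalize.comp measurable_toMeasure
  have : IsMarkovKernel (subsampleInputs q hq m) := by
    unfold subsampleInputs
    infer_instance
  have h := (hY.hasCondDistrib_input measurable_superpose
    (fun j => (hπ j).aemeasurable) m).comp_left hG
  refine ⟨h.aemeasurable, h.map_eq.trans (Measure.compProd_congr ?_)⟩
  filter_upwards [(ae_map_iff hπ'.aemeasurable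
    measurableSet_forall_totalMass_lt_top).2 hfin] with c hc
  rw [Kernel.map_apply _ hG]
  exact termKernel_map_normalize T q hq hinv m hc

end TwoRecursions

/-! ### Subsampled Poisson processes -/

section Thinning

variable {X : Type*} [MeasurableSpace X]

theorem lintegral_powRate_weight_ne_top (q : X → I) (hq : Measurable q) (n : ℕ)
    {ν : Measure (ℝ≥0 × X)} (hν : ∫⁻ p, (p.1 : ℝ≥0∞) ∂ν ≠ ∞) :
    ∫⁻ p, (p.1 : ℝ≥0∞) ∂powRate q n ν ≠ ∞ := by
  refine ne_top_of_le_ne_top hν ?_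
  rw [powRate, lintegral_withDensity_eq_lintegral_mul _ (by fun_prop) (by fun_prop)]
  refine lintegral_mono fun p => ?_
  have h1 : ENNReal.ofReal ((q p.2 : ℝ) ^ n) ≤ 1 :=
    ENNReal.ofReal_le_one.2 (pow_le_one₀ (q p.2).2.1 (q p.2).2.2)
  exact (mul_le_mul_left h1 _).trans (one_mul _).le

/-- Moving the points of a subsampled Poisson process with mean measure `ν` gives the same random
measure, in law, as moving the points of a Poisson process with mean measure `q ^ n • ν`. -/
theorem map_toMeasure_transition_subsample {Ω Ω' : Type*} [MeasurableSpace Ω] [MeasurableSpace Ω']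
    {P : Measure Ω} [IsProbabilityMeasure P] {P' : Measure Ω'} [IsProbabilityMeasure P']
    (T : Kernel X X) [IsMarkovKernel T] (q : X → I) (hq : Measurable q) (n k : ℕ)
    {ν : Measure (ℝ≥0 × X)} {π : Ω → Config X} {η : Ω' → Config X} (hπ : IsPoisson P π ν)
    (hη : IsPoisson P' η (powRate q n ν)) :
    ((transition T ^ k) ∘ₘ
        (subsample (fun x => q x ^ n) (measurable_pow hq n) ∘ₘ P.map π)).map toMeasure =
      ((transition T ^ k) ∘ₘ P'.map η).map toMeasure := by
  have := Measure.isProbabilityMeasure_map (μ := P) hπ.measurable.aemeasurable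
  have := Measure.isProbabilityMeasure_map (μ := P') hη.measurable.aemeasurable
  have := Measure.isProbabilityMeasure_map (f := toMeasure) (μ := (transition T ^ k) ∘ₘ
    (subsample (fun x => q x ^ n) (measurable_pow hq n) ∘ₘ P.map π))
    measurable_toMeasure.aemeasurable
  have := Measure.isProbabilityMeasure_map (f := toMeasure) (μ := (transition T ^ k) ∘ₘ P'.map η)
    measurable_toMeasure.aemeasurable
  refine ext_of_laplace fun f hf => ?_
  have hf' : Measurable fun x => (f x : ℝ≥0∞) := by fun_prop
  have hE : Measurable fun z : ℝ≥0 × X => expNeg (z.1 * f z.2) :=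
    measurable_expNeg.comp (by fun_prop)
  have hM : Measurable fun M : Measure X => expNeg (∫⁻ x, f x ∂M) :=
    measurable_expNeg.comp (Measure.measurable_lintegral hf')
  let κ := (movePoint T ^ k) ∘ₖ thinPoint (fun x => q x ^ n) (measurable_pow hq n)
  have hκ0 : ∀ x, ∀ᵐ z ∂κ (0, x), z.1 = 0 := fun x => by
    refine Kernel.ae_comp_of_ae_ae (measurableSet_eq_fun measurable_fst measurable_const) ?_
    filter_upwards [ae_thinPoint_weight_le (fun x => q x ^ n) (measurable_pow hq n) (0, x)]
      with y hy
    filter_upwards [ae_movePoint_pow_weight_eq T k y] with z hz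
    rw [hz]
    exact le_zero_iff.1 hy
  have hL : (transition T ^ k) ∘ₘ
      (subsample (fun x => q x ^ n) (measurable_pow hq n) ∘ₘ P.map π) =
      (piKernel fun _ : ℕ => κ) ∘ₘ P.map π := by
    rw [Measure.comp_assoc, transition_pow, subsample, piKernel_comp]
  rw [hL, transition_pow, lintegral_map hM measurable_toMeasure,
    lintegral_map hM measurable_toMeasure, hπ.laplace_piKernel κ hκ0 hf,
    hη.laplace_piKernel (movePoint T ^ k) (fun x => ae_movePoint_pow_weight_eq T k (0, x)) hf]
  congr 1
  rw [powRate, lintegral_withDensity_eq_lintegral_mul _ (by fun_prop)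
    (g := fun p => 1 - ∫⁻ z, expNeg (z.1 * f z.2) ∂(movePoint T ^ k) p)
    (measurable_const.sub hE.lintegral_kernel)]
  refine lintegral_congr fun p => ?_
  have hle : ∫⁻ z, expNeg (z.1 * f z.2) ∂(movePoint T ^ k) p ≤ 1 := by
    calc ∫⁻ z, expNeg (z.1 * f z.2) ∂(movePoint T ^ k) p
        ≤ ∫⁻ _, 1 ∂(movePoint T ^ k) p := lintegral_mono fun b => expNeg_le_one _
      _ = 1 := by simp
  have hzero : ∫⁻ z, expNeg (z.1 * f z.2) ∂(movePoint T ^ k) (0, p.2) = 1 := by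
    rw [lintegral_congr_ae (g := fun _ => 1) ?_]
    · simp
    · filter_upwards [ae_movePoint_pow_weight_eq T k (0, p.2)] with z hz
      simp [hz]
  rw [Kernel.lintegral_comp _ _ _ hE, lintegral_thinPoint _ _ _ hE.lintegral_kernel, hzero,
    mul_one, Pi.mul_apply]
  set a := ∫⁻ z, expNeg (z.1 * f z.2) ∂(movePoint T ^ k) p
  have hr0 : (0 : ℝ) ≤ (q p.2 : ℝ) ^ n := pow_nonneg (q p.2).2.1 n
  have hr1 : (q p.2 : ℝ) ^ n ≤ 1 := pow_le_one₀ (q p.2).2.1 (q p.2).2.2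
  have hcoe : ((q p.2 ^ n : I) : ℝ) = (q p.2 : ℝ) ^ n := rfl
  rw [hcoe]
  have hsum : ENNReal.ofReal ((q p.2 : ℝ) ^ n) + ENNReal.ofReal (1 - (q p.2 : ℝ) ^ n) = 1 := by
    rw [← ENNReal.ofReal_add hr0 (sub_nonneg.2 hr1)]
    simp
  set r := ENNReal.ofReal ((q p.2 : ℝ) ^ n)
  set r' := ENNReal.ofReal (1 - (q p.2 : ℝ) ^ n)
  have hr : r ≠ ∞ := ENNReal.ofReal_ne_top
  have hr' : r' ≠ ∞ := ENNReal.ofReal_ne_top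
  rw [ENNReal.mul_sub fun _ _ => hr, mul_one]
  calc 1 - (r * a + r') = (r + r') - (r * a + r') := by rw [hsum]
    _ = r - r * a := ENNReal.add_sub_add_eq_sub_right hr'

/-- The law of the mixture of subsampled independent Poisson processes is the law of the mixture of
any independent Poisson processes with the thinned mean measures. -/
theorem mixture_comp_subsampleInputs {Ω Ω' : Type*} [MeasurableSpace Ω] [MeasurableSpace Ω']
    {P : Measure Ω} [IsProbabilityMeasure P] {P' : Measure Ω'} [IsProbabilityMeasure P']
    (T : Kernel X X) [IsMarkovKernel T] (q : X → I) (hq : Measurable q)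
    {ν : ℕ → Measure (ℝ≥0 × X)} (hν : ∀ j, ∫⁻ p, (p.1 : ℝ≥0∞) ∂ν j ≠ ∞)
    {π : ℕ → Ω → Config X} (hπ : ∀ j, IsPoisson P (π j) (ν j)) (hind : iIndepFun π P) (m : ℕ)
    {η : Fin (m + 1) → Ω' → Config X}
    (hη : ∀ j : Fin (m + 1), IsPoisson P' (η j) (powRate q (m - j) (ν j)))
    (hind' : iIndepFun η P') :
    (mixture T m ∘ₖ subsampleInputs q hq m) ∘ₘ P.map (fun ω j => π j ω) =
      mixture T m ∘ₘ P'.map (fun ω' j => η j ω') := by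
  have hpπ : ∀ j, IsProbabilityMeasure (P.map (π j)) := fun j =>
    Measure.isProbabilityMeasure_map (hπ j).measurable.aemeasurable
  have hpη : ∀ j, IsProbabilityMeasure (P'.map (η j)) := fun j =>
    Measure.isProbabilityMeasure_map (hη j).measurable.aemeasurable
  have hs := measurableSet_totalMass_lt_top (X := X)
  have hsub : subsampleInputs q hq m ∘ₘ P.map (fun ω j => π j ω) =
      Measure.infinitePi fun j : Fin (m + 1) =>
        subsample (fun x => q x ^ (m - (j : ℕ))) (measurable_pow hq _) ∘ₘ P.map (π j) := by
    have hrestr : Measurable fun (c : ℕ → Config X) (j : Fin (m + 1)) => c j := by fun_prop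
    rw [← piKernel_comp_infinitePi,
      ← iIndepFun.map_fun_eq_infinitePi_map (X := fun j : Fin (m + 1) => π j)
        (fun j => (hπ j).measurable) (hind.precomp Fin.val_injective),
      subsampleInputs, ← Kernel.comp_deterministic_eq_comap, ← Measure.comp_assoc,
      Measure.deterministic_comp_eq_map,
      Measure.map_map hrestr (measurable_pi_lambda _ fun j => (hπ j).measurable)]
    rfl
  rw [← Measure.comp_assoc, hsub, hind'.map_fun_eq_infinitePi_map fun j => (hη j).measurable,
    mixture_comp_infinitePi_eq_map T m _ fun j => ?_,
    mixture_comp_infinitePi_eq_map T m _ fun j => ?_]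
  · congr 2
    funext j
    exact map_toMeasure_transition_subsample T q hq _ _ (hπ j) (hη j)
  · exact (ae_map_iff (hη j).measurable.aemeasurable hs).2
      ((hη j).totalMass_lt_top (lintegral_powRate_weight_ne_top q hq _ (hν j)))
  · refine Measure.ae_comp_of_ae_ae hs ?_
    filter_upwards [(ae_map_iff (hπ j).measurable.aemeasurable hs).2
      ((hπ j).totalMass_lt_top (hν j))] with c hc
    filter_upwards [ae_subsample_totalMass_le _ (measurable_pow hq (m - (j : ℕ))) c] with w hw
    exact hw.trans_lt hc

end Thinning

end

end DependentNRM

open DependentNRM in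
theorem mainTheorem1
    {X : Type*} [MeasurableSpace X]
    {Ω : Type*} [MeasurableSpace Ω] (P : Measure Ω) [IsProbabilityMeasure P]
    (T : Kernel X X) [IsMarkovKernel T]
    (q : X → I) (hq : Measurable q)
    (hqT : (∃ c : I, ∀ x, q x = c) ∨ T = Kernel.id)
    (ν : ℕ → Measure (ℝ≥0 × X)) (hν : ∀ j, IsLevyMeasure (ν j))
    (π : ℕ → Ω → Config X) (hπ : ∀ j, IsPoisson P (π j) (ν j)) (hind : iIndepFun π P)
    -- the recursion at the level of completely random measures
    (Y : ℕ → Ω → Config X)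
    (hY : IsRecursion P (transition T ∘ₖ subsample q hq) superpose π Y)
    -- the recursion at the level of normalised random measures
    (Z : ℕ → Ω → NRM X)
    (hZ : IsRecursion P (transitionNRM T ∘ₖ subsampleNRM q hq) superposeNRM
      (fun j ω => toNRM (π j ω)) Z) :
    -- the two recursions define the same dependent normalised random measures
    IdentDistrib
      (fun ω => ((fun j => π j ω, fun m => toMeasure (Z m ω).1) :
        (ℕ → Config X) × (ℕ → Measure X)))
      (fun ω => ((fun j => π j ω, fun m => normalize (toMeasure (Y m ω))) :
        (ℕ → Config X) × (ℕ → Measure X))) P P ∧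
    -- jointly with the inputs, both are the mixture built from the subsampled inputs
    (∀ m,
      HasCondDistrib (fun ω => toMeasure (Z m ω).1) (fun ω j => π j ω)
        (mixture T m ∘ₖ subsampleInputs q hq m) P ∧
      HasCondDistrib (fun ω => normalize (toMeasure (Y m ω))) (fun ω j => π j ω)
        (mixture T m ∘ₖ subsampleInputs q hq m) P) ∧
    -- in law, both are the mixture built from any independent completely random measures
    -- with the Lévy measures `q^(m - j)(dx) ν_j(dt, dx)`
    (∀ (m : ℕ) {Ω' : Type*} [MeasurableSpace Ω'] (P' : Measure Ω') [IsProbabilityMeasure P']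
      (η : Fin (m + 1) → Ω' → Config X),
      (∀ j : Fin (m + 1), IsPoisson P' (η j) (powRate q (m - j) (ν j))) → iIndepFun η P' →
      HasLaw (fun ω => toMeasure (Z m ω).1)
        (mixture T m ∘ₘ P'.map (fun ω' j => η j ω')) P ∧
      HasLaw (fun ω => normalize (toMeasure (Y m ω)))
        (mixture T m ∘ₘ P'.map (fun ω' j => η j ω')) P) := by
  have hm : ∀ j, Measurable (π j) := fun j => (hπ j).measurable
  have hm' : AEMeasurable (fun ω j => π j ω) P := (measurable_pi_lambda _ hm).aemeasurable
  have hfin : ∀ᵐ ω ∂P, ∀ j, totalMass (π j ω) < ∞ :=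
    ae_all_iff.2 fun j => (hπ j).totalMass_lt_top (hν j).finite_mean
  have hinv := rate_invariant hq hqT
  have hid := identDistrib_recursions hY hZ hm hfin
  have hcond : ∀ m,
      HasCondDistrib (fun ω => toMeasure (Z m ω).1) (fun ω j => π j ω)
        (mixture T m ∘ₖ subsampleInputs q hq m) P ∧
      HasCondDistrib (fun ω => normalize (toMeasure (Y m ω))) (fun ω j => π j ω)
        (mixture T m ∘ₖ subsampleInputs q hq m) P := by
    intro m
    have hYm := hY.hasCondDistrib_mixture hinv hm hfin m
    have hidm := hid.comp (u := fun p => (p.1, p.2 m)) (by fun_prop)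
    exact ⟨⟨hidm.aemeasurable_fst, hidm.map_eq.trans hYm.map_eq⟩, hYm⟩
  refine ⟨hid, hcond, fun m Ω' _ P' _ η hη hind' => ?_⟩
  have : IsMarkovKernel (subsampleInputs q hq m) := by
    unfold subsampleInputs
    infer_instance
  have := Measure.isProbabilityMeasure_map hm'
  rw [← mixture_comp_subsampleInputs T q hq (fun j => (hν j).finite_mean) hπ hind m hη hind']
  have hsnd : ∀ {M : Ω → Measure X}, HasCondDistrib M (fun ω j => π j ω)
      (mixture T m ∘ₖ subsampleInputs q hq m) P →
      HasLaw M ((mixture T m ∘ₖ subsampleInputs q hq m) ∘ₘ P.map (fun ω j => π j ω)) P := by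
    intro M hM
    refine ⟨hM.aemeasurable_snd, ?_⟩
    rw [← Measure.snd_compProd, ← hM.map_eq, Measure.snd_map_prodMk₀ hM.aemeasurable_fst]
  exact ⟨hsnd (hcond m).1, hsnd (hcond m).2⟩
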